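/- Let $f:\mathbb{R}^d\to\mathbb{R}$ be convex and twice differentiable with $\|\nabla^2 f(z)-\nabla^2 f(z')\|\le L\|z-z'\|$ for all $z,z'$, where $L>0$, and let $z^*$ be a minimizer of $f$, $z_0$ a starting point that is not a minimizer, $\|z_0-z^*\|\le D$. For a function $g$, $M>0$ and a positive semidefinite $H$, let $\mathrm{CRN}^{g}_M(\bar z,H)$ be the (unique) $z$ with $\nabla g(\bar z)+H(z-\bar z)+\frac M2\|z-\bar z\|(z-\bar z)=0$; computing such a point is called a step. MS-Solver$(\bar z)$, with parameters $K,M,m,\gamma$: put $g(z)=f(z)+\frac{\gamma}{3}\|z-\bar z\|^3$ and $z^{(0)}=\mathrm{CRN}^g_L(\bar z,\nabla^2g(\bar z))$; for $s=0,\dots,S-1$ with $S=\lceil K/m\rceil$ put $z_{s,0}=z^{(s)}$, $z_{s,t+1}=\mathrm{CRN}^g_M(z_{s,t},\nabla^2g(z_{s,0}))$ for $0\le t<m$, and $z^{(s+1)}=\frac1m\sum_{t=1}^m z_{s,t}$; return $\mathrm{CRN}^g_L(z^{(S)},\nabla^2g(z^{(S)}))$. One call uses $Sm+2$ steps and $S+2$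 Hessian evaluations. A-LEN, with $\alpha>1$: put $v_0=\bar z_0=z_0$, $A_0=0$, $\tilde z_1=\text{MS-Solver}(\bar z_0)$, $\lambda_1'=\lambda_1=\gamma\|\tilde z_1-\bar z_0\|$. For $t=0,1,2,\dots$: $a_{t+1}'=\frac{1}{2\lambda_{t+1}'}\bigl(1+\sqrt{1+4\lambda_{t+1}'A_t}\bigr)$, $A_{t+1}'=A_t+a_{t+1}'$, $\bar z_t=\frac{A_t}{A_{t+1}'}z_t+\frac{a_{t+1}'}{A_{t+1}'}v_t$; if $t>0$, $\tilde z_{t+1}=\text{MS-Solver}(\bar z_t)$ and $\lambda_{t+1}=\gamma\|\tilde z_{t+1}-\bar z_t\|$. If $\lambda_{t+1}\le\lambda_{t+1}'$, put $a_{t+1}=a_{t+1}'$, $A_{t+1}=A_{t+1}'$, $z_{t+1}=\tilde z_{t+1}$, $\lambda_{t+2}'=\lambda_{t+1}'/\alpha$; otherwise put $\gamma_{t+1}=\lambda_{t+1}'/\lambda_{t+1}$, $a_{t+1}=\gamma_{t+1}a_{t+1}'$, $A_{t+1}=A_t+a_{t+1}$, $z_{t+1}=\frac{(1-\gamma_{t+1})A_t}{A_{t+1}}z_t+\frac{\gamma_{t+1}A_{t+1}'}{A_{t+1}}\tilde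 z_{t+1}$, $\lambda_{t+2}'=\alpha\lambda_{t+1}'$. Finally $v_{t+1}=v_t-a_{t+1}\nabla f(\tilde z_{t+1})$. Theorem. Let $\alpha>1$, $\sigma\in(0,0.99]$ and $c=\frac{1}{2(1+2\sigma)}$. There is a constant $C$, depending only on $\alpha$ and $\sigma$, such that the following holds for all $L>0$ and all integers $m\ge1$. Run A-LEN with $$\gamma=\frac Lm,\qquad M=6m(L+2\gamma),\qquad K=\Bigl\lceil\tfrac32\Bigl(m+98\sqrt{M/\gamma}\Bigr)\ln\frac{L}{c\gamma}\Bigr\rceil .$$ Then $M\le C\,mL$ and $K\le C\,m(1+\log m)$. For all $D,\varepsilon>0$ there is a number $T$ of outer iterations such that for every dimension $d$ and all $f,z_0,z^*$ as above, $f(z_{T'})-f(z^*)\le\varepsilon$ for every $T'\ge T$, and the first $T$ outer iterations use in total at most $$C\Bigl(m+m^{5/7}\bigl(LD^3/\varepsilon\bigr)^{2/7}\Bigr)(1+\log m)$$ steps; if $\varepsilon\le LD^3/m$, they use at most $$C\Bigl(m+m^{5/7}(1+\log m)\bigl(LD^3/\varepsilon\bigr)^{2/7}\Bigr)$$ steps.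 They use at most $C\bigl(1+m^{-2/7}(LD^3/\varepsilon)^{2/7}\bigr)(1+\log m)$ Hessian evaluations; up to the logarithmic factor and the additive $1$, this is $m^{-2/7}$ times the bound $O((LD^3/\varepsilon)^{2/7})$ known for the A-NPE method, which evaluates one Hessian per iteration. -/

import Mathlib

noncomputable section

namespace ALEN

variable {E : Type*} [NormedAddCommGroup E] [InnerProductSpace ℝ E] [CompleteSpace E]

/-- The Hessian `∇²f(z)`, as the derivative of the gradient map; its norm is the operator
(spectral) norm. -/
def hessian (f : E → ℝ) (z : E) : E →L[ℝ] E := fderiv ℝ (gradient f) z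

/-- `f` is twice differentiable and its Hessian is `L`-Lipschitz. -/
structure HasLipschitzHessian (f : E → ℝ) (L : ℝ) : Prop where
  differentiable : Differentiable ℝ f
  differentiable_gradient : Differentiable ℝ (gradient f)
  lipschitz : ∀ z z' : E, ‖hessian f z - hessian f z'‖ ≤ L * ‖z - z'‖

/-- Solution set of the cubic regularized Newton (CRN) equation with (possibly old) Hessian `H`:
`F(z̄) + H(z - z̄) + (M/2)‖z - z̄‖(z - z̄) = 0`. -/
def crnOracle (F : E → E) (M : ℝ) (zbar : E) (H : E →L[ℝ] E) : Set E :=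
  {z | F zbar + H (z - zbar) + (M / 2 * ‖z - zbar‖) • (z - zbar) = 0}

/-- The CRN step: a point of the solution set. (The set is a singleton whenever `M > 0` and `H` is
symmetric positive semidefinite, as in all calls below.) -/
def crn (F : E → E) (M : ℝ) (zbar : E) (H : E →L[ℝ] E) : E :=
  Classical.epsilon fun z => z ∈ crnOracle F M zbar H

/-- The second-order proximal function `g(z) = f(z) + (γ/3)‖z - z̄‖³`. -/
def proxFun (f : E → ℝ) (γ : ℝ) (zbar z : E) : ℝ := f z + γ / 3 * ‖z - zbar‖ ^ 3

/-- A point together with the number of CRN steps and of Hessian evaluations spent. -/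
structure Counted (E : Type*) where
  point : E
  steps : ℕ
  hessians : ℕ

/-- `z_{s,t}`: the lazy CRN iterates on `g`, all using the Hessian at the snapshot `z_{s,0} = z`. -/
def lazyIter (g : E → ℝ) (M : ℝ) (z : E) : ℕ → E
  | 0 => z
  | t + 1 => crn (gradient g) M (lazyIter g M z t) (hessian g z)

/-- One epoch of the sub-solver: one Hessian evaluation and `m` lazy CRN steps, followed by
averaging `z_{s,1}, …, z_{s,m}`. -/
def epoch (g : E → ℝ) (M : ℝ) (m : ℕ) (c : Counted E) : Counted E where
  point := (1 / (m : ℝ)) • ∑ t ∈ Finset.Icc 1 m, lazyIter g M c.point t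
  steps := c.steps + m
  hessians := c.hessians + 1

/-- One CRN step on `g` with regularization `L` and the Hessian at the current point. -/
def freshStep (g : E → ℝ) (L : ℝ) (c : Counted E) : Counted E where
  point := crn (gradient g) L c.point (hessian g c.point)
  steps := c.steps + 1
  hessians := c.hessians + 1

/-- The MS-solver: a CRN step at `z̄`, then `⌈K/m⌉` epochs, then a final CRN step. -/
def msSolver (f : E → ℝ) (L : ℝ) (K : ℕ) (M : ℝ) (m : ℕ) (γ : ℝ) (zbar : E) : Counted E :=
  let g : E → ℝ := proxFun f γ zbar
  let c₀ : Counted E := freshStep g L ⟨zbar, 0, 0⟩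
  let c : Counted E := (epoch g M m)^[⌈(K : ℝ) / (m : ℝ)⌉₊] c₀
  freshStep g L c

/-- State of A-LEN after `t` outer iterations: `z_t`, `v_t`, `A_t`, the guess `λ'_{t+1}`, and the
total numbers of CRN steps and Hessian evaluations so far. -/
structure State (E : Type*) where
  z : E
  v : E
  A : ℝ
  lam' : ℝ
  steps : ℕ
  hessians : ℕ

/-- A-LEN started at `z₀`, with an MS-solver `solve`: the state after a given number of outer
iterations. The solver call at `z̄_0 = z_0` made before the loop is reused (at no additional cost)
in the first iteration. -/
def run (f : E → ℝ) (solve : E → Counted E) (α γ : ℝ) (z₀ : E) : ℕ → State E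
  | 0 =>
    let c := solve z₀
    { z := z₀, v := z₀, A := 0, lam' := γ * ‖c.point - z₀‖,
      steps := c.steps, hessians := c.hessians }
  | t + 1 =>
    let s := run f solve α γ z₀ t
    let a' : ℝ := 1 / (2 * s.lam') * (1 + √(1 + 4 * s.lam' * s.A))
    let A' : ℝ := s.A + a'
    let zbar : E := (s.A / A') • s.z + (a' / A') • s.v
    let c : Counted E := if t = 0 then ⟨(solve z₀).point, 0, 0⟩ else solve zbar
    let lam : ℝ := if t = 0 then s.lam' else γ * ‖c.point - zbar‖
    if lam ≤ s.lam' then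
      { z := c.point
        v := s.v - a' • gradient f c.point
        A := A'
        lam' := 1 / α * s.lam'
        steps := s.steps + c.steps
        hessians := s.hessians + c.hessians }
    else
      let ρ : ℝ := s.lam' / lam
      let a : ℝ := ρ * a'
      let A : ℝ := s.A + a
      { z := ((1 - ρ) * s.A / A) • s.z + (ρ * A' / A) • c.point
        v := s.v - a • gradient f c.point
        A := A
        lam' := α * s.lam'
        steps := s.steps + c.steps
        hessians := s.hessians + c.hessians }

/-- The regularization parameter `M = 6m(L + 2γ)` of the MS-solver. -/
def paramM (L γ : ℝ) (m : ℕ) : ℝ := 6 * m * (L + 2 * γ)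

/-- The constant `c = 1 / (2(1 + 2σ))`. -/
def paramc (σ : ℝ) : ℝ := 1 / (2 * (1 + 2 * σ))

/-- The iteration parameter `K = ⌈(3/2)(m + 98 √(M/γ)) ln(L/(cγ))⌉` of the MS-solver. -/
def paramK (σ L γ : ℝ) (m : ℕ) : ℕ :=
  ⌈3 / 2 * (m + 98 * √(paramM L γ m / γ)) * Real.log (L / (paramc σ * γ))⌉₊

/-- A-LEN with `γ = L/m` and the above parameters of the MS-solver: the state after `T` outer
iterations. -/
def alen (f : E → ℝ) (L : ℝ) (m : ℕ) (α σ : ℝ) (z₀ : E) (T : ℕ) : State E :=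
  let γ : ℝ := L / m
  run f (msSolver f L (paramK σ L γ m) (paramM L γ m) m γ) α γ z₀ T

end ALEN

end

/-!
The proximal function `g = f + γ/3 ‖· - z̄‖³` is uniformly convex of degree three. Comparing the
lazy CRN steps with the points `x + τ (x* - x)`, where `x*` minimizes `g` and `τ` is of order
`√(γ/M)`, shows that an epoch multiplies the gap of `g` by at most `1 - (2/9) τ m`; the error from
the outdated Hessian is absorbed by the cubic terms because `M` is of order `m L`. After `⌈K/m⌉`
epochs the distance to `x*` has shrunk by the factor `1/(10 m)`, and then the quadratic accuracy
of a CRN step with a fresh Hessian gives the Monteiro–Svaiter condition `‖∇f(z) + λ (z - z̄)‖ ≤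
(5/8) λ ‖z - z̄‖`, where `λ = γ ‖z - z̄‖`.

For such a solver the energy `A (f(z) - f(z*)) + ½ ‖v - z*‖²` never increases. An accepted step
raises `√A` by at least `1/(2 √λ')` and then lowers the guess `λ'`; a damped step dissipates an
energy of order at least `A λ'³/γ²` and then raises `λ'`. In logarithmic coordinates this makes a
potential increase by a fixed amount in every iteration, while it stays bounded by a multiple of
`A^(2/7)`. Hence `A` is at least of order `T^(7/2)` after `T` iterations, and `f(z) - f(z*)` is at
most the initial energy divided by `A`.
-/

noncomputable section

namespace ALEN

open Filter Finset
open scoped RealInnerProductSpace Topology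

section Calculus

section Path

variable {F : Type*} [NormedAddCommGroup F] [NormedSpace ℝ F]

lemma hasDerivAt_comp_add_smul {G : Type*} [NormedAddCommGroup G] [NormedSpace ℝ G] {φ : F → G}
    {φ' : F →L[ℝ] G} {x h : F} {t : ℝ} (hφ : HasFDerivAt φ φ' (x + t • h)) :
    HasDerivAt (fun s : ℝ => φ (x + s • h)) (φ' h) t :=
  hφ.comp_hasDerivAt t (by simpa using ((hasDerivAt_id t).smul_const h).const_add x)

lemma norm_sub_le_of_norm_deriv_le_pow {φ φ' : ℝ → F} {C : ℝ} (n : ℕ)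
    (hφ : ∀ t, HasDerivAt φ (φ' t) t) (hbound : ∀ t ∈ Set.Ico (0 : ℝ) 1, ‖φ' t‖ ≤ C * t ^ n) :
    ‖φ 1 - φ 0‖ ≤ C / (n + 1) := by
  have hB (t : ℝ) : HasDerivAt (fun t : ℝ => C / (n + 1) * t ^ (n + 1)) (C * t ^ n) t := by
    refine ((hasDerivAt_pow (n + 1) t).const_mul (C / (n + 1))).congr_deriv ?_
    simp only [Nat.cast_add, Nat.cast_one, Nat.add_sub_cancel]
    field_simp
  simpa using image_norm_le_of_norm_deriv_right_le_deriv_boundary (f := fun t => φ t - φ 0)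
    (fun t _ => ((hφ t).sub_const _).continuousAt.continuousWithinAt)
    (fun t _ => ((hφ t).sub_const _).hasDerivWithinAt) (by simp) hB hbound
    (Set.right_mem_Icc.2 zero_le_one)

lemma convexOn_comp_line {f : F → ℝ} (hc : ConvexOn ℝ Set.univ f) (x h : F) :
    ConvexOn ℝ Set.univ (fun s : ℝ => f (x + s • h)) := by
  have hline : (fun s : ℝ => f (x + s • h)) = f ∘ AffineMap.lineMap x (x + h) := by
    ext s
    simp [AffineMap.lineMap_apply_module', add_comm]
  exact hline ▸ hc.comp_affineMap (AffineMap.lineMap x (x + h))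

end Path

variable {E : Type*} [NormedAddCommGroup E] [InnerProductSpace ℝ E] [CompleteSpace E]
  {f : E → ℝ} {L : ℝ}

lemma hasDerivAt_comp_line (hf : Differentiable ℝ f) (x h : E) (t : ℝ) :
    HasDerivAt (fun s : ℝ => f (x + s • h)) ⟪gradient f (x + t • h), h⟫ t :=
  hasDerivAt_comp_add_smul (hf (x + t • h)).hasGradientAt.hasFDerivAt

lemma add_inner_gradient_le (hc : ConvexOn ℝ Set.univ f) (hf : Differentiable ℝ f) (x y : E) :
    f x + ⟪gradient f x, y - x⟫ ≤ f y := by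
  have h := (convexOn_comp_line hc x (y - x)).le_slope_of_hasDerivAt (Set.mem_univ 0)
    (Set.mem_univ 1) one_pos (hasDerivAt_comp_line hf x (y - x) 0)
  simp only [slope_def_field, zero_smul, one_smul, add_zero, add_sub_cancel, sub_zero,
    div_one] at h
  linarith

lemma isPositive_hessian (hc : ConvexOn ℝ Set.univ f) (hf : Differentiable ℝ f) {z : E}
    (hz : DifferentiableAt ℝ (gradient f) z) : (hessian f z).IsPositive := by
  refine (ContinuousLinearMap.isPositive_iff _).2 ⟨fun x y => ?_, fun h => ?_⟩
  · have hf' (y : E) : HasFDerivAt f (innerSL ℝ (gradient f y)) y :=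
      (hf y).hasGradientAt.hasFDerivAt
    have hf'' : HasFDerivAt (fun y => innerSL ℝ (gradient f y))
        ((innerSL ℝ).comp (hessian f z)) z :=
      (innerSL ℝ).hasFDerivAt.comp z hz.hasFDerivAt
    simpa [real_inner_comm] using second_derivative_symmetric hf' hf'' x y
  · have hline := hasDerivAt_comp_line hf z h
    have hmono : Monotone fun t : ℝ => ⟪gradient f (z + t • h), h⟫ := by
      rw [← monotoneOn_univ, ← funext fun t => (hline t).deriv]
      exact (convexOn_comp_line hc z h).monotoneOn_deriv
        fun t _ => (hline t).differentiableAt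
    have hgrad : HasDerivAt (fun t : ℝ => gradient f (z + t • h)) (hessian f z h) 0 :=
      hasDerivAt_comp_add_smul (by simpa [hessian] using hz.hasFDerivAt)
    have hderiv : HasDerivAt (fun t : ℝ => ⟪gradient f (z + t • h), h⟫) ⟪hessian f z h, h⟫ 0 := by
      simpa using hgrad.inner ℝ (hasDerivAt_const (0 : ℝ) h)
    exact hderiv.deriv ▸ hmono.deriv_nonneg

namespace HasLipschitzHessian

lemma hasFDerivAt_gradient (hf : HasLipschitzHessian f L) (z : E) :
    HasFDerivAt (gradient f) (hessian f z) z :=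
  (hf.differentiable_gradient z).hasFDerivAt

lemma norm_gradient_sub_le (hf : HasLipschitzHessian f L) (x h : E) :
    ‖gradient f (x + h) - gradient f x - hessian f x h‖ ≤ L / 2 * ‖h‖ ^ 2 := by
  have hφ (t : ℝ) : HasDerivAt (fun t : ℝ => gradient f (x + t • h) - t • hessian f x h)
      ((hessian f (x + t • h) - hessian f x) h) t := by
    simpa using! (hasDerivAt_comp_add_smul (hf.hasFDerivAt_gradient _)).sub
      ((hasDerivAt_id t).smul_const (hessian f x h))
  have hbound (t : ℝ) (ht : t ∈ Set.Ico (0 : ℝ) 1) :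
      ‖(hessian f (x + t • h) - hessian f x) h‖ ≤ L * ‖h‖ ^ 2 * t ^ 1 :=
    calc ‖(hessian f (x + t • h) - hessian f x) h‖
        ≤ L * ‖x + t • h - x‖ * ‖h‖ :=
          ContinuousLinearMap.le_of_opNorm_le _ (hf.lipschitz _ _) h
      _ = L * ‖h‖ ^ 2 * t ^ 1 := by
          rw [add_sub_cancel_left, norm_smul, Real.norm_of_nonneg ht.1]; ring
  convert norm_sub_le_of_norm_deriv_le_pow 1 hφ hbound using 1
  · simp [sub_right_comm]
  · push_cast; ring

lemma abs_sub_le (hf : HasLipschitzHessian f L) (x h : E) :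
    |f (x + h) - f x - ⟪gradient f x, h⟫ - 1 / 2 * ⟪hessian f x h, h⟫| ≤ L / 6 * ‖h‖ ^ 3 := by
  have hφ (t : ℝ) : HasDerivAt
      (fun t : ℝ => f (x + t • h) - t * ⟪gradient f x, h⟫ - t ^ 2 * (1 / 2 * ⟪hessian f x h, h⟫))
      ⟪gradient f (x + t • h) - gradient f x - hessian f x (t • h), h⟫ t := by
    refine (((hasDerivAt_comp_line hf.differentiable x h t).sub
      ((hasDerivAt_id t).mul_const ⟪gradient f x, h⟫)).sub
      ((hasDerivAt_pow 2 t).mul_const (1 / 2 * ⟪hessian f x h, h⟫))).congr_deriv ?_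
    simp only [inner_sub_left, map_smul, real_inner_smul_left]
    ring
  have hbound (t : ℝ) (ht : t ∈ Set.Ico (0 : ℝ) 1) :
      ‖⟪gradient f (x + t • h) - gradient f x - hessian f x (t • h), h⟫‖ ≤
        L / 2 * ‖h‖ ^ 3 * t ^ 2 :=
    calc ‖⟪gradient f (x + t • h) - gradient f x - hessian f x (t • h), h⟫‖
        ≤ L / 2 * ‖t • h‖ ^ 2 * ‖h‖ :=
          (norm_inner_le_norm _ _).trans (by gcongr; exact hf.norm_gradient_sub_le _ _)
      _ = L / 2 * ‖h‖ ^ 3 * t ^ 2 := by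
          rw [norm_smul, Real.norm_of_nonneg ht.1]; ring
  convert norm_sub_le_of_norm_deriv_le_pow 2 hφ hbound using 1
  · rw [Real.norm_eq_abs]
    congr 1
    simp only [one_smul, zero_smul, add_zero]
    ring
  · push_cast; ring

end HasLipschitzHessian

end Calculus

section CubicNorm

open NormedSpace (normalize norm_smul_normalize)

variable {E : Type*} [NormedAddCommGroup E] [InnerProductSpace ℝ E]

/-- The Hessian of `‖x‖³ / 3`, that is, the derivative of `x ↦ ‖x‖ x`. -/
def cubicHessian (x : E) : E →L[ℝ] E :=
  ‖x‖ • .id ℝ E + (innerSL ℝ (normalize x)).smulRight x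

lemma hasFDerivAt_norm_smul (x : E) : HasFDerivAt (fun y : E => ‖y‖ • y) (cubicHessian x) x := by
  rcases eq_or_ne x 0 with rfl | hx
  · rw [hasFDerivAt_iff_isLittleO_nhds_zero, ← Asymptotics.isLittleO_norm_left]
    simpa [cubicHessian, norm_smul, ← sq] using
      Asymptotics.isLittleO_norm_pow_id (E' := E) one_lt_two
  · have hnorm : HasFDerivAt (fun y : E => ‖y‖) (innerSL ℝ (normalize x)) x := by
      have h := (hasStrictFDerivAt_norm_sq x).hasFDerivAt.sqrt (by simpa using hx)
      simp only [Real.sqrt_sq (norm_nonneg _)] at h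
      refine h.congr_fderiv ?_
      ext v
      simp [NormedSpace.normalize]
      ring
    exact hnorm.smul (hasFDerivAt_id x)

lemma norm_smul_normalize_sub_le {x y : E} (hxy : ‖y‖ ≤ ‖x‖) :
    ‖‖y‖ • normalize x - y‖ ≤ ‖x - y‖ := by
  set w := ‖y‖ • normalize x - y
  have hsplit : x - y = w + (‖x‖ - ‖y‖) • normalize x := by
    nth_rw 1 [← norm_smul_normalize x]
    module
  have hinner : 0 ≤ ⟪w, normalize x⟫ := by
    rcases eq_or_ne x 0 with rfl | hx
    · simp
    · have hcs := real_inner_le_norm y (normalize x)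
      have hunit := NormedSpace.norm_normalize hx
      rw [inner_sub_left, real_inner_smul_left, real_inner_self_eq_norm_sq, hunit]
      rw [hunit] at hcs
      linarith
  refine (sq_le_sq₀ (norm_nonneg _) (norm_nonneg _)).1 ?_
  rw [hsplit, norm_add_sq_real, real_inner_smul_right]
  have := mul_nonneg (sub_nonneg.2 hxy) hinner
  nlinarith [sq_nonneg ‖(‖x‖ - ‖y‖) • normalize x‖]

lemma norm_normalize_le_one (x : E) : ‖normalize x‖ ≤ 1 := by
  rw [NormedSpace.normalize, norm_smul, norm_inv, norm_norm]
  exact inv_mul_le_one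

lemma norm_cubicHessian_sub_le (x y : E) :
    ‖cubicHessian x - cubicHessian y‖ ≤ 3 * ‖x - y‖ := by
  wlog hxy : ‖y‖ ≤ ‖x‖ generalizing x y
  · rw [norm_sub_rev, norm_sub_rev x]
    exact this y x (le_of_not_ge hxy)
  have hsplit : cubicHessian x - cubicHessian y = (‖x‖ - ‖y‖) • .id ℝ E +
      (innerSL ℝ (normalize x)).smulRight (x - y) +
      (innerSL ℝ (‖y‖ • normalize x - y)).smulRight (normalize y) := by
    have hy : ‖y‖ • normalize y = y := norm_smul_normalize y
    ext h
    have hyh : ⟪y, h⟫ = ‖y‖ * ⟪normalize y, h⟫ := by rw [← real_inner_smul_left, hy]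
    have hyn (r : ℝ) : r • y = (r * ‖y‖) • normalize y := by rw [mul_smul, hy]
    simp only [cubicHessian, sub_apply, add_apply, smul_apply, ContinuousLinearMap.id_apply,
      ContinuousLinearMap.smulRight_apply, innerSL_apply_apply, inner_sub_left,
      real_inner_smul_left, smul_sub, hyh, hyn]
    module
  calc ‖cubicHessian x - cubicHessian y‖
      ≤ ‖(‖x‖ - ‖y‖) • ContinuousLinearMap.id ℝ E‖ +
          ‖(innerSL ℝ (normalize x)).smulRight (x - y)‖ +
          ‖(innerSL ℝ (‖y‖ • normalize x - y)).smulRight (normalize y)‖ := by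
        rw [hsplit]; exact norm_add₃_le
    _ ≤ ‖x - y‖ * 1 + 1 * ‖x - y‖ + ‖x - y‖ * 1 := by
        simp only [norm_smul, ContinuousLinearMap.norm_smulRight_apply, innerSL_apply_norm]
        gcongr
        · exact abs_norm_sub_norm_le x y
        · exact ContinuousLinearMap.norm_id_le
        · exact norm_normalize_le_one x
        · exact norm_smul_normalize_sub_le hxy
        · exact norm_normalize_le_one y
    _ = 3 * ‖x - y‖ := by ring

lemma sq_mul_sub_le_of_le_add {a b k : ℝ} (ha : 0 ≤ a) (hb : 0 ≤ b) (hk : k ≤ a + b) :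
    k ^ 2 * (k - 3 * b) ≤ (a - b) ^ 2 * (2 * a + b) := by
  rcases le_total k (3 * b) with hkb | hkb
  · exact (mul_nonpos_of_nonneg_of_nonpos (sq_nonneg k) (by linarith)).trans (by positivity)
  · have hab : 0 ≤ a - b := by linarith
    calc k ^ 2 * (k - 3 * b) ≤ (a + b) ^ 2 * (a + b - 3 * b) := by
          gcongr; linarith
      _ ≤ (a - b) ^ 2 * (2 * a + b) := by
          linear_combination pow_nonneg hab 3 + 4 * pow_nonneg hb 3

lemma norm_cube_add_inner_add_le (u v : E) :
    1 / 3 * ‖v‖ ^ 3 + ‖v‖ * ⟪v, u - v⟫ + 1 / 6 * ‖u - v‖ ^ 3 ≤ 1 / 3 * ‖u‖ ^ 3 := by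
  have hinner : 2 * ⟪v, u - v⟫ = ‖u‖ ^ 2 - ‖v‖ ^ 2 - ‖u - v‖ ^ 2 := by
    have h := norm_add_sq_real v (u - v)
    rw [add_sub_cancel] at h
    linarith
  have hscalar := sq_mul_sub_le_of_le_add (norm_nonneg u) (norm_nonneg v) (norm_sub_le u v)
  linear_combination 1 / 6 * hscalar + 1 / 2 * ‖v‖ * hinner

lemma hasFDerivAt_norm_cube (x : E) :
    HasFDerivAt (fun y : E => ‖y‖ ^ 3) ((3 * ‖x‖) • innerSL ℝ x) x := by
  have h := hasFDerivAt_norm_rpow x (p := 3) (by norm_num)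
  norm_num at h
  exact h

end CubicNorm

section Existence

variable {F : Type*} [NormedAddCommGroup F] [NormedSpace ℝ F]

lemma modulus_le_of_uniformConvexOn {φ : ℝ → ℝ} {g : F → ℝ} (hg : UniformConvexOn Set.univ φ g)
    {b : ℝ} (hb : ∀ z, b ≤ g z) (x y : F) : φ ‖x - y‖ ≤ 2 * (g x - b) + 2 * (g y - b) := by
  have h := hg.2 (Set.mem_univ x) (Set.mem_univ y) one_half_pos.le one_half_pos.le (add_halves 1)
  have hmid := hb ((1 / 2 : ℝ) • x + (1 / 2 : ℝ) • y)
  simp only [smul_eq_mul] at h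
  linarith

/-- Minimizing sequences are Cauchy, so no compactness is needed. -/
lemma exists_forall_le_of_uniformConvexOn [CompleteSpace F] {φ : ℝ → ℝ} {g : F → ℝ}
    (hg : UniformConvexOn Set.univ φ g) (hφ : MonotoneOn φ (Set.Ici 0))
    (hφ_pos : ∀ r, 0 < r → 0 < φ r) (hcont : Continuous g) (hbdd : BddBelow (Set.range g)) :
    ∃ zs, ∀ z, g zs ≤ g z := by
  obtain ⟨u, -, hu, hmem⟩ := exists_seq_tendsto_sInf (Set.range_nonempty g) hbdd
  choose z hz using hmem
  have hgz : Tendsto (fun n => g (z n)) atTop (𝓝 (⨅ x, g x)) := by simpa only [hz] using! hu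
  have hcauchy : CauchySeq z := by
    refine Metric.cauchySeq_iff.2 fun ε hε => ?_
    have hclose : ∀ᶠ n in atTop, g (z n) < (⨅ x, g x) + φ ε / 4 :=
      hgz.eventually_lt_const (by linarith [hφ_pos ε hε])
    obtain ⟨N, hN⟩ := eventually_atTop.1 hclose
    refine ⟨N, fun i hi j hj => ?_⟩
    by_contra! hij
    rw [dist_eq_norm] at hij
    linarith [hN i hi, hN j hj, modulus_le_of_uniformConvexOn hg (ciInf_le hbdd) (z i) (z j),
      hφ hε.le (hε.le.trans hij) hij]
  obtain ⟨zs, hzs⟩ := cauchySeq_tendsto_of_complete hcauchy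
  have hmin : g zs = ⨅ x, g x :=
    tendsto_nhds_unique ((hcont.tendsto zs).comp hzs) hgz
  exact ⟨zs, fun x => hmin.trans_le (ciInf_le hbdd x)⟩

end Existence

section Prox

variable {E : Type*} [NormedAddCommGroup E] [InnerProductSpace ℝ E] {f : E → ℝ} {L γ : ℝ}

lemma uniformConvexOn_norm_cube :
    UniformConvexOn Set.univ (fun r => 1 / 12 * |r| ^ 3) fun z : E => 1 / 3 * ‖z‖ ^ 3 := by
  refine ⟨convex_univ, fun x _ y _ a b ha hb hab => ?_⟩
  obtain rfl : b = 1 - a := by linarith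
  set z := a • x + (1 - a) • y with hz
  have hx := norm_cube_add_inner_add_le x z
  have hy := norm_cube_add_inner_add_le y z
  rw [show x - z = (1 - a) • (x - y) by rw [hz]; module, norm_smul, Real.norm_of_nonneg hb,
    real_inner_smul_right] at hx
  rw [show y - z = (-a) • (x - y) by rw [hz]; module, norm_smul, norm_neg,
    Real.norm_of_nonneg ha, real_inner_smul_right] at hy
  have hweights : 0 ≤ a * (1 - a) * (2 * a - 1) ^ 2 * ‖x - y‖ ^ 3 := by positivity
  simp only [smul_eq_mul, abs_norm]
  linear_combination a * hx + (1 - a) * hy + 1 / 12 * hweights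

lemma uniformConvexOn_proxFun (hc : ConvexOn ℝ Set.univ f) (hγ : 0 ≤ γ) (zbar : E) :
    UniformConvexOn Set.univ (fun r => γ / 12 * |r| ^ 3) (proxFun f γ zbar) := by
  refine ⟨convex_univ, fun x _ y _ a b ha hb hab => ?_⟩
  have hf := hc.2 (Set.mem_univ x) (Set.mem_univ y) ha hb hab
  have hcube := uniformConvexOn_norm_cube.2 (Set.mem_univ (x - zbar)) (Set.mem_univ (y - zbar))
    ha hb hab
  have hsplit : a • (x - zbar) + b • (y - zbar) = a • x + b • y - zbar := by
    obtain rfl : b = 1 - a := by linarith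
    module
  rw [hsplit, sub_sub_sub_cancel_right] at hcube
  simp only [smul_eq_mul] at hf hcube
  simp only [proxFun, smul_eq_mul]
  linear_combination hf + γ * hcube

lemma convexOn_proxFun (hc : ConvexOn ℝ Set.univ f) (hγ : 0 ≤ γ) (zbar : E) :
    ConvexOn ℝ Set.univ (proxFun f γ zbar) :=
  (uniformConvexOn_proxFun hc hγ zbar).convexOn fun r => by positivity

variable [CompleteSpace E]

lemma hasGradientAt_proxFun (hf : Differentiable ℝ f) (γ : ℝ) (zbar z : E) :
    HasGradientAt (proxFun f γ zbar) (gradient f z + (γ * ‖z - zbar‖) • (z - zbar)) z := by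
  have hcube : HasFDerivAt (fun z : E => ‖z - zbar‖ ^ 3)
      ((3 * ‖z - zbar‖) • innerSL ℝ (z - zbar)) z :=
    (hasFDerivAt_comp_sub zbar).2 (hasFDerivAt_norm_cube (z - zbar))
  rw [hasGradientAt_iff_hasFDerivAt]
  refine ((hf z).hasGradientAt.hasFDerivAt.add (hcube.const_mul (γ / 3))).congr_fderiv ?_
  ext h
  simp
  ring

lemma gradient_proxFun (hf : Differentiable ℝ f) (γ : ℝ) (zbar z : E) :
    gradient (proxFun f γ zbar) z = gradient f z + (γ * ‖z - zbar‖) • (z - zbar) :=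
  (hasGradientAt_proxFun hf γ zbar z).gradient

lemma differentiable_proxFun (hf : Differentiable ℝ f) (γ : ℝ) (zbar : E) :
    Differentiable ℝ (proxFun f γ zbar) :=
  fun z => (hasGradientAt_proxFun hf γ zbar z).hasFDerivAt.differentiableAt

lemma HasLipschitzHessian.hasFDerivAt_gradient_proxFun (hf : HasLipschitzHessian f L)
    (γ : ℝ) (zbar z : E) :
    HasFDerivAt (gradient (proxFun f γ zbar)) (hessian f z + γ • cubicHessian (z - zbar)) z := by
  have hcube : HasFDerivAt (fun z : E => ‖z - zbar‖ • (z - zbar)) (cubicHessian (z - zbar)) z :=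
    (hasFDerivAt_comp_sub zbar).2 (hasFDerivAt_norm_smul (z - zbar))
  refine ((hf.hasFDerivAt_gradient z).add (hcube.const_smul γ)).congr_of_eventuallyEq
    (.of_forall fun z => ?_)
  simp [gradient_proxFun hf.differentiable, mul_smul]

lemma hasLipschitzHessian_proxFun (hf : HasLipschitzHessian f L) (hγ : 0 ≤ γ) (zbar : E) :
    HasLipschitzHessian (proxFun f γ zbar) (L + 3 * γ) where
  differentiable := differentiable_proxFun hf.differentiable γ zbar
  differentiable_gradient z := (hf.hasFDerivAt_gradient_proxFun γ zbar z).differentiableAt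
  lipschitz z z' := by
    rw [hessian, hessian, (hf.hasFDerivAt_gradient_proxFun γ zbar z).fderiv,
      (hf.hasFDerivAt_gradient_proxFun γ zbar z').fderiv, add_sub_add_comm, ← smul_sub]
    calc _ ≤ ‖hessian f z - hessian f z'‖ +
          ‖γ • (cubicHessian (z - zbar) - cubicHessian (z' - zbar))‖ := norm_add_le _ _
      _ ≤ L * ‖z - z'‖ + γ * (3 * ‖z - z'‖) := by
        rw [norm_smul, Real.norm_of_nonneg hγ]
        gcongr
        · exact hf.lipschitz _ _
        · simpa using norm_cubicHessian_sub_le (z - zbar) (z' - zbar)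
      _ = (L + 3 * γ) * ‖z - z'‖ := by ring

/-- Growth of the third degree around a minimizer `zs`, with the constant that uniform convexity
gives for the proximal functions `proxFun f γ zbar`. -/
def HasCubicGrowthAt (g : E → ℝ) (γ : ℝ) (zs : E) : Prop :=
  ∀ z, γ / 6 * ‖z - zs‖ ^ 3 ≤ g z - g zs

lemma hasCubicGrowthAt_proxFun (hc : ConvexOn ℝ Set.univ f) (hf : Differentiable ℝ f)
    (hγ : 0 ≤ γ) {zbar zs : E} (hs : gradient (proxFun f γ zbar) zs = 0) :
    HasCubicGrowthAt (proxFun f γ zbar) γ zs := by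
  intro z
  have hcube := mul_le_mul_of_nonneg_left
    (norm_cube_add_inner_add_le (z - zbar) (zs - zbar)) hγ
  have hgrad : ⟪gradient f zs, z - zs⟫ = -(γ * ‖zs - zbar‖ * ⟪zs - zbar, z - zs⟫) := by
    rw [gradient_proxFun hf] at hs
    rw [eq_neg_of_add_eq_zero_left hs, inner_neg_left, real_inner_smul_left]
  rw [sub_sub_sub_cancel_right] at hcube
  unfold proxFun
  linear_combination hcube + add_inner_gradient_le hc hf zs z - hgrad

lemma bddBelow_range_proxFun (hc : ConvexOn ℝ Set.univ f) (hf : Differentiable ℝ f)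
    (hγ : 0 < γ) (zbar : E) : BddBelow (Set.range (proxFun f γ zbar)) := by
  set b := ‖gradient f zbar‖
  refine ⟨f zbar - b * (1 + 3 * b / γ), Set.forall_mem_range.2 fun z => ?_⟩
  set r := ‖z - zbar‖
  have hr : 0 ≤ r := norm_nonneg _
  have hb : 0 ≤ b := norm_nonneg _
  have hgrad : f zbar - b * r ≤ f z := by
    have hinner := (abs_le.1 (abs_real_inner_le_norm (gradient f zbar) (z - zbar))).1
    linarith [add_inner_gradient_le hc hf zbar z]
  have hscalar : b * r ≤ γ / 3 * r ^ 3 + b * (1 + 3 * b / γ) := by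
    rcases le_total r (1 + 3 * b / γ) with hsmall | hlarge
    · have := mul_le_mul_of_nonneg_left hsmall hb
      have : 0 ≤ γ / 3 * r ^ 3 := by positivity
      linarith
    · have hquot : 0 ≤ 3 * b / γ := by positivity
      have hsq : 3 * b / γ ≤ r ^ 2 := by nlinarith
      have hbsq : b ≤ γ / 3 * r ^ 2 := by
        rw [div_le_iff₀ hγ] at hsq
        linarith
      have := mul_le_mul_of_nonneg_right hbsq hr
      nlinarith [mul_nonneg hb hquot]
  simp only [proxFun]
  linarith

lemma exists_gradient_proxFun_eq_zero (hc : ConvexOn ℝ Set.univ f) (hf : Differentiable ℝ f)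
    (hγ : 0 < γ) (zbar : E) : ∃ zs, gradient (proxFun f γ zbar) zs = 0 := by
  obtain ⟨zs, hzs⟩ := exists_forall_le_of_uniformConvexOn (uniformConvexOn_proxFun hc hγ.le zbar)
    (fun r hr s _ hrs => by
      have hr : 0 ≤ r := hr
      simp only [abs_of_nonneg hr, abs_of_nonneg (hr.trans hrs)]
      gcongr)
    (fun r hr => by positivity) (differentiable_proxFun hf γ zbar).continuous
    (bddBelow_range_proxFun hc hf hγ zbar)
  have hmin : IsLocalMin (proxFun f γ zbar) zs := .of_forall hzs
  exact ⟨zs, by simp [gradient, hmin.fderiv_eq_zero]⟩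

end Prox

section CRN

variable {E : Type*} [NormedAddCommGroup E] [InnerProductSpace ℝ E] {F : E → E} {x z : E}
  {H : E →L[ℝ] E} {L M : ℝ}

/-- The quadratic part of the model that a CRN step minimizes: `b` stands for the gradient and `H`
for the Hessian, so that the cubic model is `proxFun (quadModel b H) (M / 2) 0`. -/
def quadModel (b : E) (H : E →L[ℝ] E) (h : E) : ℝ := ⟪b, h⟫ + 1 / 2 * ⟪H h, h⟫

lemma convexOn_quadModel (b : E) (hH : H.IsPositive) : ConvexOn ℝ Set.univ (quadModel b H) := by
  refine ⟨convex_univ, fun u _ v _ a c ha hc hac => ?_⟩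
  obtain rfl : c = 1 - a := by linarith
  have hpos := mul_nonneg (mul_nonneg ha hc) (hH.inner_nonneg_left (u - v))
  simp only [quadModel, map_add, map_sub, map_smul, inner_add_left, inner_add_right,
    inner_sub_left, inner_sub_right, real_inner_smul_left, real_inner_smul_right,
    smul_eq_mul] at hpos ⊢
  linear_combination 1 / 2 * hpos

lemma norm_sub_le_of_mem_crnOracle (hH : H.IsPositive) (hL : 0 < L)
    (hz : z ∈ crnOracle F L x H) {w : E} (hw : ‖F x + H (w - x)‖ ≤ 2 * L * ‖w - x‖ ^ 2) :
    ‖z - x‖ ≤ 3 * ‖w - x‖ := by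
  obtain ⟨h, rfl⟩ : ∃ h, z = x + h := ⟨z - x, by abel⟩
  obtain ⟨k, rfl⟩ : ∃ k, w = x + k := ⟨w - x, by abel⟩
  simp only [crnOracle, Set.mem_ofPred_eq, add_sub_cancel_left] at hz hw ⊢
  have hmono : 0 ≤ ⟪H (h - k), h - k⟫ := hH.inner_nonneg_left _
  have hroot : ⟪F x + H k, h - k⟫ + ⟪H (h - k), h - k⟫ + L / 2 * ‖h‖ * (‖h‖ ^ 2 - ⟪h, k⟫) = 0 := by
    have h0 : ⟪F x + H h + (L / 2 * ‖h‖) • h, h - k⟫ = 0 := by rw [hz, inner_zero_left]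
    simp only [map_sub, inner_sub_left, inner_sub_right, inner_add_left, real_inner_smul_left,
      real_inner_self_eq_norm_sq] at h0 ⊢
    linarith
  have hlin : -⟪F x + H k, h - k⟫ ≤ 2 * L * ‖k‖ ^ 2 * (‖h‖ + ‖k‖) :=
    calc -⟪F x + H k, h - k⟫ ≤ ‖F x + H k‖ * ‖h - k‖ :=
          (neg_le_abs _).trans (abs_real_inner_le_norm _ _)
      _ ≤ 2 * L * ‖k‖ ^ 2 * (‖h‖ + ‖k‖) := by gcongr; exact norm_sub_le h k
  have hcubic : ‖h‖ ^ 2 * (‖h‖ - ‖k‖) ≤ 4 * ‖k‖ ^ 2 * (‖h‖ + ‖k‖) := by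
    refine le_of_mul_le_mul_left ?_ (half_pos hL)
    linear_combination hlin + hmono + hroot +
      mul_nonneg (by positivity : 0 ≤ L / 2 * ‖h‖) (sub_nonneg.2 (real_inner_le_norm h k))
  by_contra! hlt
  obtain ⟨d, hd, hd'⟩ : ∃ d, 0 < d ∧ ‖h‖ = 3 * ‖k‖ + d := ⟨‖h‖ - 3 * ‖k‖, by linarith, by ring⟩
  have hpos : 0 < 2 * ‖k‖ ^ 3 + 17 * ‖k‖ ^ 2 * d + 8 * ‖k‖ * d ^ 2 + d ^ 3 := by positivity
  rw [hd'] at hcubic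
  linarith

variable [CompleteSpace E]

lemma hasGradientAt_quadModel (b h : E) (hH : H.IsPositive) :
    HasGradientAt (quadModel b H) (b + H h) h := by
  rw [hasGradientAt_iff_hasFDerivAt]
  refine ((innerSL ℝ b).hasFDerivAt.add
    ((H.hasFDerivAt.inner ℝ (hasFDerivAt_id h)).const_mul (1 / 2))).congr_fderiv ?_
  ext k
  have hsymm : ⟪H k, h⟫ = ⟪H h, k⟫ := (hH.inner_left_eq_inner_right k h).trans (real_inner_comm _ _)
  simp [hsymm]
  ring

lemma gradient_proxFun_quadModel (hH : H.IsPositive) (b h : E) :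
    gradient (proxFun (quadModel b H) (M / 2) 0) h = b + H h + (M / 2 * ‖h‖) • h := by
  rw [gradient_proxFun fun h => (hasGradientAt_quadModel b h hH).hasFDerivAt.differentiableAt,
    (hasGradientAt_quadModel b h hH).gradient, sub_zero]

lemma crn_mem_crnOracle (F : E → E) (hM : 0 < M) (x : E) (hH : H.IsPositive) :
    crn F M x H ∈ crnOracle F M x H := by
  obtain ⟨h, hh⟩ := exists_gradient_proxFun_eq_zero (convexOn_quadModel (F x) hH)
    (fun h => (hasGradientAt_quadModel (F x) h hH).hasFDerivAt.differentiableAt) (half_pos hM) 0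
  refine Classical.epsilon_spec (p := fun z => z ∈ crnOracle F M x H) ⟨x + h, ?_⟩
  simpa [crnOracle, gradient_proxFun_quadModel hH] using hh

lemma proxFun_quadModel_le (hH : H.IsPositive) (hM : 0 ≤ M) (hz : z ∈ crnOracle F M x H) (w : E) :
    proxFun (quadModel (F x) H) (M / 2) 0 (z - x) ≤
      proxFun (quadModel (F x) H) (M / 2) 0 (w - x) := by
  have hgrowth := hasCubicGrowthAt_proxFun (convexOn_quadModel (F x) hH)
    (fun h => (hasGradientAt_quadModel (F x) h hH).hasFDerivAt.differentiableAt) (by positivity)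
    ((gradient_proxFun_quadModel hH (F x) (z - x)).trans hz) (w - x)
  exact sub_nonneg.1 (hgrowth.trans' (by positivity))

variable {g : E → ℝ} {N : ℝ}

lemma HasLipschitzHessian.norm_gradient_le_of_mem_crnOracle (hg : HasLipschitzHessian g N)
    (hM : 0 ≤ M) (hz : z ∈ crnOracle (gradient g) M x (hessian g x)) :
    ‖gradient g z‖ ≤ (N + M) / 2 * ‖z - x‖ ^ 2 := by
  have htaylor := hg.norm_gradient_sub_le x (z - x)
  rw [add_sub_cancel] at htaylor
  have hsplit : gradient g z = (gradient g z - gradient g x - hessian g x (z - x)) -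
      (M / 2 * ‖z - x‖) • (z - x) := by
    rw [eq_sub_iff_add_eq, ← sub_eq_zero, ← (hz : _ = _)]
    abel
  calc ‖gradient g z‖ ≤ N / 2 * ‖z - x‖ ^ 2 + ‖(M / 2 * ‖z - x‖) • (z - x)‖ := by
        rw [hsplit]
        exact (norm_sub_le _ _).trans (by gcongr)
    _ = (N + M) / 2 * ‖z - x‖ ^ 2 := by
        rw [norm_smul, Real.norm_of_nonneg (by positivity)]; ring

end CRN

section LazyEpoch

variable {E : Type*} [NormedAddCommGroup E] [InnerProductSpace ℝ E] [CompleteSpace E]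
  {g : E → ℝ} {N M γ τ : ℝ} {m : ℕ} {w x z zs : E}

lemma HasLipschitzHessian.abs_inner_hessian_sub_le (hg : HasLipschitzHessian g N) (x w v : E) :
    |⟪hessian g x v, v⟫ - ⟪hessian g w v, v⟫| ≤ N * ‖x - w‖ * ‖v‖ ^ 2 := by
  rw [← inner_sub_left, ← sub_apply]
  calc |⟪(hessian g x - hessian g w) v, v⟫| ≤ ‖(hessian g x - hessian g w) v‖ * ‖v‖ :=
        abs_real_inner_le_norm _ _
    _ ≤ ‖hessian g x - hessian g w‖ * ‖v‖ * ‖v‖ := by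
        gcongr
        exact ContinuousLinearMap.le_opNorm _ _
    _ ≤ N * ‖x - w‖ * ‖v‖ * ‖v‖ := by
        gcongr
        exact hg.lipschitz x w
    _ = N * ‖x - w‖ * ‖v‖ ^ 2 := by ring

lemma HasLipschitzHessian.le_of_mem_crnOracle (hg : HasLipschitzHessian g N)
    (hw : (hessian g w).IsPositive) (hM : 0 ≤ M)
    (hz : z ∈ crnOracle (gradient g) M x (hessian g w)) (y : E) :
    g z ≤ g y + N / 2 * ‖x - w‖ * (‖z - x‖ ^ 2 + ‖y - x‖ ^ 2) + (N + M) / 6 * ‖y - x‖ ^ 3 -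
      (M - N) / 6 * ‖z - x‖ ^ 3 := by
  have hz_taylor := (abs_le.1 (hg.abs_sub_le x (z - x))).2
  have hy_taylor := (abs_le.1 (hg.abs_sub_le x (y - x))).1
  have hmodel := proxFun_quadModel_le hw hM hz y
  have hz_hessian := (abs_le.1 (hg.abs_inner_hessian_sub_le x w (z - x))).2
  have hy_hessian := (abs_le.1 (hg.abs_inner_hessian_sub_le x w (y - x))).1
  rw [add_sub_cancel] at hz_taylor hy_taylor
  simp only [proxFun, quadModel, sub_zero] at hmodel
  linarith

lemma mul_sq_le_add_cube {a r μ : ℝ} (ha : 0 ≤ a) (hr : 0 ≤ r) (hμ : 0 < μ) :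
    1 / 2 * (a * r ^ 2) ≤ a ^ 3 / (6 * μ ^ 2) + μ / 3 * r ^ 3 := by
  have hfactor : a ^ 3 / (6 * μ ^ 2) + μ / 3 * r ^ 3 - 1 / 2 * (a * r ^ 2) =
      (a - μ * r) ^ 2 * (a + 2 * (μ * r)) / (6 * μ ^ 2) := by
    field_simp
    ring
  have hnonneg : 0 ≤ (a - μ * r) ^ 2 * (a + 2 * (μ * r)) / (6 * μ ^ 2) := by positivity
  linarith

lemma HasLipschitzHessian.gap_le_of_mem_crnOracle (hc : ConvexOn ℝ Set.univ g)
    (hg : HasLipschitzHessian g N) (hN : 0 ≤ N) (hM : 0 ≤ M) {μ : ℝ} (hμ : 1 ≤ μ)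
    (hMN : 9 * (μ * N) ≤ 2 * M) (hgrow : HasCubicGrowthAt g γ zs) (hτ : 0 ≤ τ) (hτ1 : τ ≤ 1)
    (hMτ : 10 * M * τ ^ 2 ≤ 3 * γ) (hz : z ∈ crnOracle (gradient g) M x (hessian g w)) :
    g z - g zs ≤ (1 - τ / 2) * (g x - g zs) +
      (N / (3 * μ ^ 2) * ‖x - w‖ ^ 3 + (N * (μ / 3) - (M - N) / 6) * ‖z - x‖ ^ 3) := by
  have hstep := hg.le_of_mem_crnOracle
    (isPositive_hessian hc hg.differentiable hg.differentiable_gradient.differentiableAt)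
    hM hz (x + τ • (zs - x))
  rw [add_sub_cancel_left, norm_smul, Real.norm_of_nonneg hτ, norm_sub_rev zs] at hstep
  have hconv : g (x + τ • (zs - x)) ≤ (1 - τ) * g x + τ * g zs := by
    have h := hc.2 (Set.mem_univ x) (Set.mem_univ zs) (sub_nonneg.2 hτ1) hτ (by ring)
    rwa [show (1 - τ) • x + τ • zs = x + τ • (zs - x) by module] at h
  have hyoung {r : ℝ} (hr : 0 ≤ r) : N / 2 * ‖x - w‖ * r ^ 2 ≤
      1 / 2 * (N / (3 * μ ^ 2) * ‖x - w‖ ^ 3) + N * (μ / 3) * r ^ 3 := by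
    have h := mul_le_mul_of_nonneg_left
      (mul_sq_le_add_cube (norm_nonneg (x - w)) hr (zero_lt_one.trans_le hμ)) hN
    rw [mul_add, show N * (‖x - w‖ ^ 3 / (6 * μ ^ 2)) =
      1 / 2 * (N / (3 * μ ^ 2) * ‖x - w‖ ^ 3) by field_simp; ring] at h
    linarith
  have hyoung_z := hyoung (norm_nonneg (z - x))
  have hyoung_y := hyoung (mul_nonneg hτ (norm_nonneg (x - zs)))
  have hgap : (N * (μ / 3) + (N + M) / 6) * (τ * ‖x - zs‖) ^ 3 ≤ τ / 2 * (g x - g zs) :=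
    calc (N * (μ / 3) + (N + M) / 6) * (τ * ‖x - zs‖) ^ 3
      _ ≤ 5 * M / 18 * (τ * ‖x - zs‖) ^ 3 := by gcongr; nlinarith
      _ = τ / 36 * (10 * M * τ ^ 2) * ‖x - zs‖ ^ 3 := by ring
      _ ≤ τ / 36 * (3 * γ) * ‖x - zs‖ ^ 3 := by gcongr
      _ = τ / 2 * (γ / 6 * ‖x - zs‖ ^ 3) := by ring
      _ ≤ τ / 2 * (g x - g zs) := by gcongr; exact hgrow x
  linarith

lemma sum_range_sq_le (j : ℕ) : ∑ t ∈ range j, (t : ℝ) ^ 2 ≤ (j : ℝ) ^ 3 / 3 := by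
  induction j with
  | zero => simp
  | succ j ih =>
    rw [sum_range_succ]
    push_cast
    linear_combination ih + (Nat.cast_nonneg j : (0 : ℝ) ≤ j)

lemma sum_norm_sub_cube_le {V : Type*} [SeminormedAddCommGroup V] (x : ℕ → V) (j : ℕ) :
    ∑ t ∈ range j, ‖x t - x 0‖ ^ 3 ≤ (j : ℝ) ^ 3 / 3 * ∑ t ∈ range j, ‖x (t + 1) - x t‖ ^ 3 := by
  have hdrift : ∀ t ∈ range j, ‖x t - x 0‖ ^ 3 ≤
      (t : ℝ) ^ 2 * ∑ i ∈ range j, ‖x (i + 1) - x i‖ ^ 3 := by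
    intro t ht
    calc ‖x t - x 0‖ ^ 3 ≤ (∑ i ∈ range t, ‖x (i + 1) - x i‖) ^ 3 := by
          rw [← sum_range_sub x t]
          gcongr
          exact norm_sum_le _ _
      _ ≤ (t : ℝ) ^ 2 * ∑ i ∈ range t, ‖x (i + 1) - x i‖ ^ 3 := by
          simpa using pow_sum_le_card_mul_sum_pow (s := range t)
            (f := fun i => ‖x (i + 1) - x i‖) (fun _ _ => norm_nonneg _) 2
      _ ≤ (t : ℝ) ^ 2 * ∑ i ∈ range j, ‖x (i + 1) - x i‖ ^ 3 := by
          gcongr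
          exact (mem_range.1 ht).le
  calc ∑ t ∈ range j, ‖x t - x 0‖ ^ 3
    _ ≤ ∑ t ∈ range j, (t : ℝ) ^ 2 * ∑ i ∈ range j, ‖x (i + 1) - x i‖ ^ 3 := sum_le_sum hdrift
    _ = (∑ t ∈ range j, (t : ℝ) ^ 2) * ∑ i ∈ range j, ‖x (i + 1) - x i‖ ^ 3 := by rw [sum_mul]
    _ ≤ (j : ℝ) ^ 3 / 3 * ∑ i ∈ range j, ‖x (i + 1) - x i‖ ^ 3 := by
        gcongr
        exact sum_range_sq_le j

lemma HasLipschitzHessian.sum_gap_le (hc : ConvexOn ℝ Set.univ g) (hg : HasLipschitzHessian g N)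
    (hN : 0 ≤ N) (hM : 0 ≤ M) (hm : 1 ≤ m) (hMN : 9 * (m * N) ≤ 2 * M)
    (hgrow : HasCubicGrowthAt g γ zs) (hτ : 0 ≤ τ) (hτ1 : τ ≤ 1) (hMτ : 10 * M * τ ^ 2 ≤ 3 * γ)
    {x : ℕ → E} (hx : ∀ t, x (t + 1) ∈ crnOracle (gradient g) M (x t) (hessian g (x 0)))
    {j : ℕ} (hj : j ≤ m) :
    ∑ t ∈ range j, (g (x (t + 1)) - g zs) ≤ (1 - τ / 2) * ∑ t ∈ range j, (g (x t) - g zs) := by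
  have hm1 : (1 : ℝ) ≤ m := by exact_mod_cast hm
  have hsum := sum_le_sum fun t (_ : t ∈ range j) =>
    hg.gap_le_of_mem_crnOracle hc hN hM hm1 hMN hgrow hτ hτ1 hMτ (hx t)
  rw [sum_add_distrib, sum_add_distrib, ← mul_sum, ← mul_sum, ← mul_sum] at hsum
  set lengths := ∑ t ∈ range j, ‖x (t + 1) - x t‖ ^ 3
  have hlengths : 0 ≤ lengths := sum_nonneg fun _ _ => by positivity
  have hdrift : N / (3 * (m : ℝ) ^ 2) * ∑ t ∈ range j, ‖x t - x 0‖ ^ 3 ≤ N * m / 9 * lengths :=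
    calc N / (3 * (m : ℝ) ^ 2) * ∑ t ∈ range j, ‖x t - x 0‖ ^ 3
      _ ≤ N / (3 * (m : ℝ) ^ 2) * ((m : ℝ) ^ 3 / 3 * lengths) := by
          gcongr
          exact (sum_norm_sub_cube_le x j).trans (by gcongr)
      _ = N * m / 9 * lengths := by field_simp; ring
  have habsorb : (N * m / 9 + (N * (m / 3) - (M - N) / 6)) * lengths ≤ 0 :=
    mul_nonpos_of_nonpos_of_nonneg (by nlinarith) hlengths
  linarith

lemma sum_le_of_shifted_sum_le {δ : ℕ → ℝ} {p : ℝ} (hδ : 0 ≤ δ 0) (hp : 0 ≤ p)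
    (hpm : p * m ≤ 1 / 4) (h : ∀ j ≤ m, ∑ t ∈ range j, δ (t + 1) ≤ (1 - p) * ∑ t ∈ range j, δ t) :
    ∀ j ≤ m, ∑ t ∈ range j, δ (t + 1) ≤ (j - 4 / 9 * p * (j * (j + 1))) * δ 0 := by
  intro j
  induction j with
  | zero => simp
  | succ j ih =>
    intro hj
    have hjm : (j : ℝ) + 1 ≤ m := by exact_mod_cast hj
    have hpj : p * j + p ≤ 1 / 4 := by nlinarith
    have hj0 := mul_nonneg hp (Nat.cast_nonneg' j : (0 : ℝ) ≤ j)
    calc ∑ t ∈ range (j + 1), δ (t + 1) ≤ (1 - p) * (∑ t ∈ range j, δ (t + 1) + δ 0) := by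
          rw [← sum_range_succ' δ j]
          exact h (j + 1) hj
      _ ≤ (1 - p) * ((j - 4 / 9 * p * (j * (j + 1))) * δ 0 + δ 0) := by
          gcongr
          · linarith
          · exact ih (by lia)
      _ = (1 - p) * (j - 4 / 9 * p * (j * (j + 1)) + 1) * δ 0 := by ring
      _ ≤ (↑(j + 1) - 4 / 9 * p * (↑(j + 1) * (↑(j + 1) + 1))) * δ 0 := by
          gcongr
          push_cast
          have hslack : 0 ≤ p * (j + 1) * (1 / 9 - 4 / 9 * (p * j)) :=
            mul_nonneg (by positivity) (by linarith)
          linear_combination hslack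

lemma sub_epoch_point_le (hc : ConvexOn ℝ Set.univ g) (hm : 1 ≤ m) (a : ℝ) (c : Counted E) :
    g (epoch g M m c).point - a ≤
      1 / (m : ℝ) * ∑ t ∈ range m, (g (lazyIter g M c.point (t + 1)) - a) := by
  have hm0 : (0 : ℝ) < m := by exact_mod_cast hm
  have hpoint : (epoch g M m c).point =
      ∑ t ∈ range m, (1 / (m : ℝ)) • lazyIter g M c.point (t + 1) := by
    rw [← smul_sum, range_eq_Ico, sum_Ico_add' (lazyIter g M c.point) 0 m 1]
    rfl
  have hjensen : g (epoch g M m c).point ≤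
      ∑ t ∈ range m, (1 / (m : ℝ)) * g (lazyIter g M c.point (t + 1)) := by
    rw [hpoint]
    refine hc.map_sum_le (fun _ _ => by positivity) ?_ fun _ _ => Set.mem_univ _
    rw [sum_const, card_range, nsmul_eq_mul, mul_one_div_cancel hm0.ne']
  rw [sum_sub_distrib, sum_const, card_range, nsmul_eq_mul, mul_sub, mul_sum, ← mul_assoc,
    one_div_mul_cancel hm0.ne', one_mul]
  linarith

lemma HasLipschitzHessian.epoch_gap_le (hc : ConvexOn ℝ Set.univ g)
    (hg : HasLipschitzHessian g N) (hN : 0 ≤ N) (hM : 0 < M) (hγ : 0 ≤ γ) (hm : 1 ≤ m)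
    (hMN : 9 * (m * N) ≤ 2 * M) (hgrow : HasCubicGrowthAt g γ zs) (hτ : 0 ≤ τ) (hτm : τ * m ≤ 1 / 2)
    (hMτ : 10 * M * τ ^ 2 ≤ 3 * γ) (c : Counted E) :
    g (epoch g M m c).point - g zs ≤ (1 - 2 / 9 * (τ * m)) * (g c.point - g zs) := by
  have hm1 : (1 : ℝ) ≤ m := by exact_mod_cast hm
  have hgap : 0 ≤ g c.point - g zs := (hgrow c.point).trans' (by positivity)
  have hiter (t : ℕ) : lazyIter g M c.point (t + 1) ∈
      crnOracle (gradient g) M (lazyIter g M c.point t) (hessian g c.point) :=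
    crn_mem_crnOracle _ hM _
      (isPositive_hessian hc hg.differentiable hg.differentiable_gradient.differentiableAt)
  have hsum := sum_le_of_shifted_sum_le (δ := fun t => g (lazyIter g M c.point t) - g zs) hgap
    (div_nonneg hτ zero_le_two) (by linarith) (fun j hj => hg.sum_gap_le hc hN hM.le hm hMN hgrow hτ
      (by nlinarith) hMτ hiter hj) m le_rfl
  calc g (epoch g M m c).point - g zs
    _ ≤ 1 / (m : ℝ) * ((m - 4 / 9 * (τ / 2) * (m * (m + 1))) * (g c.point - g zs)) :=
        (sub_epoch_point_le hc hm _ c).trans (by gcongr; exact hsum)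
    _ = (1 - 2 / 9 * (τ * (m + 1))) * (g c.point - g zs) := by field_simp; ring
    _ ≤ (1 - 2 / 9 * (τ * m)) * (g c.point - g zs) := by gcongr; linarith

end LazyEpoch

section Parameters

variable {L M γ σ : ℝ} {m : ℕ}

/-- The weight `τ` of the minimizer in the test point `x + τ (zs - x)` of the lazy steps. Any `τ`
with `10 M τ ^ 2 ≤ 3 γ` works, and `109 / 200` is slightly less than `√(3 / 10)`. -/
def lazyRate (M γ : ℝ) : ℝ := 109 / 200 / √(M / γ)

lemma lazyRate_nonneg (M γ : ℝ) : 0 ≤ lazyRate M γ := by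
  unfold lazyRate
  positivity

lemma mul_lazyRate_sq_le (hM : 0 < M) (hγ : 0 < γ) : 10 * M * lazyRate M γ ^ 2 ≤ 3 * γ := by
  rw [lazyRate, div_pow, Real.sq_sqrt (by positivity)]
  field_simp
  norm_num

lemma lazyRate_mul_le (hγ : 0 < γ) (hm : 1 ≤ m) (h : 2 * m ^ 2 * γ ≤ M) :
    lazyRate M γ * m ≤ 1 / 2 := by
  have hm0 : (0 : ℝ) < m := by exact_mod_cast hm
  have hM : 0 < M := h.trans_lt' (by positivity)
  have hsqrt : 109 / 100 * m ≤ √(M / γ) := by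
    refine Real.le_sqrt_of_sq_le ((le_div_iff₀ hγ).2 (h.trans' ?_))
    nlinarith [mul_pos (pow_pos hm0 2) hγ]
  rw [lazyRate, div_mul_eq_mul_div, div_le_iff₀ (Real.sqrt_pos.2 (by positivity))]
  linarith

lemma one_sub_pow_le_inv_pow {q x : ℝ} (hq : q ≤ 1) (hx : 0 < x) {n S : ℕ}
    (h : n * Real.log x ≤ q * S) : (1 - q) ^ S ≤ (x ^ n)⁻¹ :=
  calc (1 - q) ^ S ≤ Real.exp (-q) ^ S :=
        pow_le_pow_left₀ (sub_nonneg.2 hq) (Real.one_sub_le_exp_neg q) S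
    _ = Real.exp (-(q * S)) := by rw [← Real.exp_nat_mul]; ring_nf
    _ ≤ Real.exp (-(n * Real.log x)) := Real.exp_le_exp.2 (neg_le_neg h)
    _ = (x ^ n)⁻¹ := by rw [Real.exp_neg, Real.exp_nat_mul, Real.exp_log hx]

lemma paramM_pos (hL : 0 < L) (hm : 1 ≤ m) : 0 < paramM L (L / m) m := by
  have : (0 : ℝ) < m := by exact_mod_cast hm
  unfold paramM
  positivity

lemma paramM_div (hL : 0 < L) (hm : 1 ≤ m) :
    paramM L (L / m) m / (L / m) = 6 * m * (m + 2) := by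
  have : (0 : ℝ) < m := by exact_mod_cast hm
  unfold paramM
  field_simp

lemma div_paramc_mul (hL : 0 < L) (hm : 1 ≤ m) (hσ : 0 ≤ σ) :
    L / (paramc σ * (L / m)) = 2 * m * (1 + 2 * σ) := by
  have : (0 : ℝ) < m := by exact_mod_cast hm
  unfold paramc
  field_simp

lemma mul_log_le_paramK (hL : 0 < L) (hm : 1 ≤ m) (hσ : 0 ≤ σ) :
    147 * √(paramM L (L / m) m / (L / m)) * Real.log (2 * m) ≤ paramK σ L (L / m) m := by
  have hm1 : (1 : ℝ) ≤ m := by exact_mod_cast hm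
  have hlog : Real.log (2 * m) ≤ Real.log (2 * m * (1 + 2 * σ)) :=
    Real.log_le_log (by positivity) (le_mul_of_one_le_right (by positivity) (by linarith))
  have hlog0 : 0 ≤ Real.log (2 * m) := Real.log_nonneg (by linarith)
  rw [paramK, div_paramc_mul hL hm hσ]
  set W := √(paramM L (L / m) m / (L / m))
  have : 0 ≤ W := Real.sqrt_nonneg _
  calc 147 * W * Real.log (2 * m) ≤ 147 * W * Real.log (2 * m * (1 + 2 * σ)) := by gcongr
    _ ≤ 3 / 2 * (m + 98 * W) * Real.log (2 * m * (1 + 2 * σ)) :=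
        mul_le_mul_of_nonneg_right (by linarith) (hlog0.trans hlog)
    _ ≤ ⌈3 / 2 * (m + 98 * W) * Real.log (2 * m * (1 + 2 * σ))⌉₊ := Nat.le_ceil _

lemma contraction_pow_le (hL : 0 < L) (hm : 1 ≤ m) (hσ : 0 ≤ σ) :
    (1 - 2 / 9 * (lazyRate (paramM L (L / m) m) (L / m) * m)) ^
      ⌈(paramK σ L (L / m) m : ℝ) / (m : ℝ)⌉₊ ≤ ((2 * (m : ℝ)) ^ 17)⁻¹ := by
  have hm1 : (1 : ℝ) ≤ m := by exact_mod_cast hm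
  have hm0 : (0 : ℝ) < m := by linarith
  set S := ⌈(paramK σ L (L / m) m : ℝ) / (m : ℝ)⌉₊
  have hrate : lazyRate (paramM L (L / m) m) (L / m) * m ≤ 1 / 2 := by
    refine lazyRate_mul_le (by positivity) hm ?_
    rw [← le_div_iff₀ (by positivity), paramM_div hL hm]
    nlinarith
  refine one_sub_pow_le_inv_pow (by linarith) (by positivity) ?_
  have hW : 0 < √(paramM L (L / m) m / (L / m)) :=
    Real.sqrt_pos.2 (div_pos (paramM_pos hL hm) (by positivity))
  have hK := mul_log_le_paramK hL hm hσ
  rw [lazyRate]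
  set W := √(paramM L (L / m) m / (L / m))
  have hKS : (paramK σ L (L / m) m : ℝ) ≤ m * S := by
    rw [← div_le_iff₀' hm0]
    exact Nat.le_ceil _
  have hlog0 : 0 ≤ Real.log (2 * m) := Real.log_nonneg (by linarith)
  calc ((17 : ℕ) : ℝ) * Real.log (2 * m)
    _ ≤ 2 / 9 * (109 / 200) * 147 * Real.log (2 * m) := by gcongr; norm_num
    _ = 2 / 9 * (109 / 200 / W) * (147 * W * Real.log (2 * m)) := by field_simp
    _ ≤ 2 / 9 * (109 / 200 / W) * (m * S) :=
        mul_le_mul_of_nonneg_left (hK.trans hKS) (by positivity)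
    _ = 2 / 9 * (109 / 200 / W * m) * S := by ring

end Parameters

section Solver

variable {E : Type*} [NormedAddCommGroup E] [InnerProductSpace ℝ E] [CompleteSpace E]
  {f g : E → ℝ} {L M N γ τ σ : ℝ} {m : ℕ} {zs : E}

lemma iterate_epoch_steps (g : E → ℝ) (M : ℝ) (m S : ℕ) (c : Counted E) :
    ((epoch g M m)^[S] c).steps = c.steps + S * m := by
  induction S with
  | zero => simp
  | succ S ih =>
    rw [Function.iterate_succ_apply', epoch, ih]
    ring

lemma iterate_epoch_hessians (g : E → ℝ) (M : ℝ) (m S : ℕ) (c : Counted E) :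
    ((epoch g M m)^[S] c).hessians = c.hessians + S := by
  induction S with
  | zero => rfl
  | succ S ih =>
    rw [Function.iterate_succ_apply', epoch, ih]
    ring

lemma msSolver_steps (f : E → ℝ) (L : ℝ) (K : ℕ) (M : ℝ) (m : ℕ) (γ : ℝ) (zbar : E) :
    (msSolver f L K M m γ zbar).steps = ⌈(K : ℝ) / (m : ℝ)⌉₊ * m + 2 := by
  simp only [msSolver, freshStep, iterate_epoch_steps]
  ring

lemma msSolver_hessians (f : E → ℝ) (L : ℝ) (K : ℕ) (M : ℝ) (m : ℕ) (γ : ℝ) (zbar : E) :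
    (msSolver f L K M m γ zbar).hessians = ⌈(K : ℝ) / (m : ℝ)⌉₊ + 2 := by
  simp only [msSolver, freshStep, iterate_epoch_hessians]
  ring

lemma HasLipschitzHessian.freshStep_mem_crnOracle (hc : ConvexOn ℝ Set.univ g)
    (hg : HasLipschitzHessian g N) (hL : 0 < L) (c : Counted E) :
    (freshStep g L c).point ∈ crnOracle (gradient g) L c.point (hessian g c.point) :=
  crn_mem_crnOracle _ hL _
    (isPositive_hessian hc hg.differentiable hg.differentiable_gradient.differentiableAt)

lemma HasLipschitzHessian.norm_freshStep_sub_le (hc : ConvexOn ℝ Set.univ g)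
    (hg : HasLipschitzHessian g N) (hL : 0 < L) (hNL : N ≤ 4 * L) (hzs : gradient g zs = 0)
    (c : Counted E) : ‖(freshStep g L c).point - c.point‖ ≤ 3 * ‖zs - c.point‖ := by
  refine norm_sub_le_of_mem_crnOracle
    (isPositive_hessian hc hg.differentiable hg.differentiable_gradient.differentiableAt) hL
    (hg.freshStep_mem_crnOracle hc hL c) ?_
  have htaylor := hg.norm_gradient_sub_le c.point (zs - c.point)
  rw [add_sub_cancel, hzs, zero_sub, neg_sub_left, norm_neg, add_comm] at htaylor
  exact htaylor.trans (by gcongr; linarith)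

lemma HasLipschitzHessian.freshStep_gap_le (hc : ConvexOn ℝ Set.univ g)
    (hg : HasLipschitzHessian g N) (hL : 0 < L) (hNL : N ≤ 4 * L) (hzs : gradient g zs = 0)
    (c : Counted E) :
    g (freshStep g L c).point - g zs ≤ 43 / 3 * L * ‖zs - c.point‖ ^ 3 := by
  have hdescent := hg.le_of_mem_crnOracle
    (isPositive_hessian hc hg.differentiable hg.differentiable_gradient.differentiableAt) hL.le
    (hg.freshStep_mem_crnOracle hc hL c) zs
  rw [sub_self, norm_zero, mul_zero, zero_mul, add_zero] at hdescent
  have hlength : ‖(freshStep g L c).point - c.point‖ ^ 3 ≤ (3 * ‖zs - c.point‖) ^ 3 := by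
    gcongr
    exact hg.norm_freshStep_sub_le hc hL hNL hzs c
  have hclose : (N + L) / 6 * ‖zs - c.point‖ ^ 3 ≤ (4 * L + L) / 6 * ‖zs - c.point‖ ^ 3 := by
    gcongr
  have hfar : (N - L) / 6 * ‖(freshStep g L c).point - c.point‖ ^ 3 ≤
      (4 * L - L) / 6 * (3 * ‖zs - c.point‖) ^ 3 :=
    (mul_le_mul_of_nonneg_right (by linarith) (by positivity)).trans
      (mul_le_mul_of_nonneg_left hlength (by linarith))
  linarith

lemma HasLipschitzHessian.iterate_epoch_gap_le (hc : ConvexOn ℝ Set.univ g)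
    (hg : HasLipschitzHessian g N) (hN : 0 ≤ N) (hM : 0 < M) (hγ : 0 ≤ γ) (hm : 1 ≤ m)
    (hMN : 9 * (m * N) ≤ 2 * M) (hgrow : HasCubicGrowthAt g γ zs) (hτ : 0 ≤ τ)
    (hτm : τ * m ≤ 1 / 2) (hMτ : 10 * M * τ ^ 2 ≤ 3 * γ) (c : Counted E) (S : ℕ) :
    g ((epoch g M m)^[S] c).point - g zs ≤
      (1 - 2 / 9 * (τ * m)) ^ S * (g c.point - g zs) := by
  induction S with
  | zero => simp
  | succ S ih =>
    rw [Function.iterate_succ_apply', pow_succ', mul_assoc]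
    exact (hg.epoch_gap_le hc hN hM hγ hm hMN hgrow hτ hτm hMτ _).trans
      (mul_le_mul_of_nonneg_left ih (by linarith))

lemma le_div_of_gap_le {Δ R : ℝ} (hL : 0 < L) (hm : 1 ≤ m) (hR : 0 ≤ R)
    (h : L / m / 6 * Δ ^ 3 ≤ ((2 * (m : ℝ)) ^ 17)⁻¹ * (43 / 3 * L * R ^ 3)) :
    Δ ≤ R / (10 * m) := by
  have hm1 : (1 : ℝ) ≤ m := by exact_mod_cast hm
  have : (0 : ℝ) < m := by linarith
  refine le_of_pow_le_pow_left₀ three_ne_zero (by positivity) ?_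
  have hpow : 86000 * (m : ℝ) ^ 4 ≤ (2 * (m : ℝ)) ^ 17 :=
    calc 86000 * (m : ℝ) ^ 4 ≤ 2 ^ 17 * (m : ℝ) ^ 17 := by gcongr <;> norm_num [hm1]
      _ = (2 * (m : ℝ)) ^ 17 := (mul_pow _ _ _).symm
  refine le_of_mul_le_mul_left (a := L / m / 6) ?_ (by positivity)
  calc L / m / 6 * Δ ^ 3 ≤ (86000 * (m : ℝ) ^ 4)⁻¹ * (43 / 3 * L * R ^ 3) :=
        h.trans (by gcongr)
    _ = L / m / 6 * (R / (10 * m)) ^ 3 := by field_simp; ring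

/-- The Monteiro–Svaiter condition with tolerance `θ`: `z` is an approximate stationary point of the
second-order proximal function at `zbar`, relative to the length of the step from `zbar`. -/
def IsMSPoint (f : E → ℝ) (γ θ : ℝ) (zbar z : E) : Prop :=
  ‖gradient f z + (γ * ‖z - zbar‖) • (z - zbar)‖ ≤ θ * (γ * ‖z - zbar‖ ^ 2)

/-- A solver whose output satisfies the Monteiro–Svaiter condition at every input. -/
def IsMSSolver (f : E → ℝ) (γ θ : ℝ) (solve : E → Counted E) : Prop :=
  ∀ zbar, IsMSPoint f γ θ zbar (solve zbar).point

lemma HasLipschitzHessian.norm_iterate_epoch_sub_le (hc : ConvexOn ℝ Set.univ f)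
    (hf : HasLipschitzHessian f L) (hL : 0 < L) (hm : 1 ≤ m) (hσ : 0 ≤ σ) (c : Counted E)
    (hzs : gradient (proxFun f (L / m) c.point) zs = 0) :
    ‖((epoch (proxFun f (L / m) c.point) (paramM L (L / m) m) m)^[
      ⌈(paramK σ L (L / m) m : ℝ) / (m : ℝ)⌉₊]
        (freshStep (proxFun f (L / m) c.point) L c)).point - zs‖ ≤
      ‖zs - c.point‖ / (10 * m) := by
  have hm1 : (1 : ℝ) ≤ m := by exact_mod_cast hm
  have hM := paramM_pos hL hm
  have hγ : 0 < L / m := by positivity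
  have hγL : L / m ≤ L := div_le_self hL.le hm1
  have hγm : L / m * m = L := div_mul_cancel₀ L (by positivity)
  have hgrow := hasCubicGrowthAt_proxFun hc hf.differentiable hγ.le hzs
  have hg := hasLipschitzHessian_proxFun hf hγ.le c.point
  have hgc := convexOn_proxFun hc hγ.le c.point
  have hfirst := hg.freshStep_gap_le hgc hL (by linarith) hzs c
  have hcontract := contraction_pow_le hL hm hσ
  have hepochs := fun hMN hrate => hg.iterate_epoch_gap_le hgc (by positivity) hM hγ.le hm hMN
    hgrow (lazyRate_nonneg _ _) hrate (mul_lazyRate_sq_le hM hγ)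
    (freshStep (proxFun f (L / m) c.point) L c) ⌈(paramK σ L (L / m) m : ℝ) / (m : ℝ)⌉₊
  have hgap := hepochs (by rw [paramM]; nlinarith)
    (lazyRate_mul_le hγ hm (by rw [paramM]; nlinarith))
  refine le_div_of_gap_le hL hm (norm_nonneg _) ((hgrow _).trans (hgap.trans ?_))
  exact mul_le_mul hcontract hfirst ((hgrow _).trans' (by positivity)) (by positivity)

theorem HasLipschitzHessian.isMSSolver_msSolver (hc : ConvexOn ℝ Set.univ f)
    (hf : HasLipschitzHessian f L) (hL : 0 < L) (hm : 1 ≤ m) (hσ : 0 ≤ σ) :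
    IsMSSolver f (L / m) (5 / 8)
      (msSolver f L (paramK σ L (L / m) m) (paramM L (L / m) m) m (L / m)) := by
  intro zbar
  have hm1 : (1 : ℝ) ≤ m := by exact_mod_cast hm
  have hγ : 0 < L / m := by positivity
  have hγL : L / m ≤ L := div_le_self hL.le hm1
  obtain ⟨zs, hzs⟩ := exists_gradient_proxFun_eq_zero hc hf.differentiable hγ zbar
  have hg := hasLipschitzHessian_proxFun hf hγ.le zbar
  have hgc := convexOn_proxFun hc hγ.le zbar
  have hclose := hf.norm_iterate_epoch_sub_le hc hL hm hσ ⟨zbar, 0, 0⟩ hzs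
  rw [IsMSPoint, msSolver, ← gradient_proxFun hf.differentiable]
  set g := proxFun f (L / m) zbar
  set c := (epoch g (paramM L (L / m) m) m)^[⌈(paramK σ L (L / m) m : ℝ) / (m : ℝ)⌉₊]
    (freshStep g L ⟨zbar, 0, 0⟩)
  set z := (freshStep g L c).point
  change ‖c.point - zs‖ ≤ ‖zs - zbar‖ / (10 * m) at hclose
  have hstep : ‖z - c.point‖ ≤ 3 * (‖zs - zbar‖ / (10 * m)) := by
    refine (hg.norm_freshStep_sub_le hgc hL (by linarith) hzs c).trans ?_
    rw [norm_sub_rev]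
    gcongr
  have hdist : 3 / 5 * ‖zs - zbar‖ ≤ ‖z - zbar‖ := by
    have htriangle : ‖zs - zbar‖ ≤ ‖z - zbar‖ + ‖z - c.point‖ + ‖c.point - zs‖ :=
      calc ‖zs - zbar‖ = ‖(z - zbar) - (z - c.point) - (c.point - zs)‖ := by congr 1; abel
        _ ≤ ‖z - zbar‖ + ‖z - c.point‖ + ‖c.point - zs‖ :=
          (norm_sub_le _ _).trans (by gcongr; exact norm_sub_le _ _)
    have hsmall : ‖zs - zbar‖ / (10 * m) ≤ ‖zs - zbar‖ / 10 := by gcongr; linarith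
    linarith
  calc ‖gradient g z‖ ≤ (L + 3 * (L / m) + L) / 2 * ‖z - c.point‖ ^ 2 :=
        hg.norm_gradient_le_of_mem_crnOracle hL.le (hg.freshStep_mem_crnOracle hgc hL c)
    _ ≤ (L + 3 * L + L) / 2 * (3 * (‖zs - zbar‖ / (10 * m))) ^ 2 := by gcongr
    _ = 5 / 8 * (L / m / m * (3 / 5 * ‖zs - zbar‖) ^ 2) := by field_simp; ring
    _ ≤ 5 / 8 * (L / m * ‖z - zbar‖ ^ 2) := by gcongr

end Solver

section Potential

variable {β ω ξ ξ' η η' e e' q q' h : ℝ}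

lemma le_mul_sq_sub_sq (hq : 0 ≤ q) (hqq' : q ≤ q') (hq' : q' ≤ 2 * q)
    (hh : q ^ 3 + 1 / 2 * h ≤ q' ^ 3) : h ≤ 6 * q * (q' ^ 2 - q ^ 2) := by
  have hcube : q' ^ 3 - q ^ 3 ≤ (q' ^ 2 - q ^ 2) * (q' + q) := by
    linear_combination mul_nonneg (mul_nonneg hq (hq.trans hqq')) (sub_nonneg.2 hqq')
  have hdouble : (q' ^ 2 - q ^ 2) * (q' + q) ≤ (q' ^ 2 - q ^ 2) * (3 * q) :=
    mul_le_mul_of_nonneg_left (by linarith) (sub_nonneg.2 (pow_le_pow_left₀ hq hqq' 2))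
  linarith

/-- The part of `potential` that grows by at least `1` whenever the balance `η - ξ - ω` moves away
from `0`. -/
def reserve (β ω ξ e : ℝ) : ℝ :=
  -(Real.exp (6 * β + 6 * ω) * e) + 6 * Real.exp (β - ω) * Real.exp (2 * ξ) + ξ / Real.log 2

/-- The potential of the amortized analysis. Here `exp (6 * ξ)` is the weight `A` and
`exp (-2 * η)` the guess for `λ`, both in normalized units, `e` is the remaining energy, and `ω` is
the target value of `η - ξ`, around which the accepted and damped steps alternate. -/
def potential (β ω ξ η e : ℝ) : ℝ := -|η - ξ - ω| + ξ + 2 * β * reserve β ω ξ e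

lemma reserve_mono (hξ : ξ ≤ ξ') (he : e' ≤ e) : reserve β ω ξ e ≤ reserve β ω ξ' e' := by
  have : 0 < Real.log 2 := Real.log_pos one_lt_two
  unfold reserve
  gcongr

lemma one_le_mul_exp_sub_exp (hξ : Real.exp (3 * ξ) + 1 / 2 * Real.exp η ≤ Real.exp (3 * ξ'))
    (hξξ' : ξ ≤ ξ') (hdouble : ξ' - ξ ≤ Real.log 2) (hnear : -β ≤ η - ξ - ω) :
    1 ≤ 6 * Real.exp (β - ω) * (Real.exp (2 * ξ') - Real.exp (2 * ξ)) := by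
  have hq' : Real.exp ξ' ≤ 2 * Real.exp ξ := by
    rw [← Real.exp_log two_pos, ← Real.exp_add]
    exact Real.exp_le_exp.2 (by linarith)
  have hη : Real.exp η ≤ 6 * Real.exp ξ * (Real.exp (2 * ξ') - Real.exp (2 * ξ)) := by
    have hpow (n : ℕ) (s : ℝ) : Real.exp (n * s) = Real.exp s ^ n := Real.exp_nat_mul s n
    have h3 := hpow 3
    have h2 := hpow 2
    push_cast at h2 h3
    rw [h2, h2]
    rw [h3, h3] at hξ
    exact le_mul_sq_sub_sq (Real.exp_pos ξ).le (Real.exp_le_exp.2 hξξ') hq' hξ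
  calc 1 ≤ Real.exp (β - ω - ξ) * Real.exp η := by
        rw [← Real.exp_add]
        exact Real.one_le_exp (by linarith)
    _ ≤ Real.exp (β - ω - ξ) * (6 * Real.exp ξ * (Real.exp (2 * ξ') - Real.exp (2 * ξ))) := by
        gcongr
    _ = 6 * (Real.exp (β - ω - ξ) * Real.exp ξ) * (Real.exp (2 * ξ') - Real.exp (2 * ξ)) := by
        ring
    _ = 6 * Real.exp (β - ω) * (Real.exp (2 * ξ') - Real.exp (2 * ξ)) := by
        rw [← Real.exp_add, sub_add_cancel]

lemma reserve_add_one_le_of_accept (hξ : Real.exp (3 * ξ) + 1 / 2 * Real.exp η ≤ Real.exp (3 * ξ'))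
    (hξξ' : ξ ≤ ξ') (he : e' ≤ e) (hnear : -β ≤ η - ξ - ω) :
    reserve β ω ξ e + 1 ≤ reserve β ω ξ' e' := by
  have hlog2 : 0 < Real.log 2 := Real.log_pos one_lt_two
  have henergy : Real.exp (6 * β + 6 * ω) * e' ≤ Real.exp (6 * β + 6 * ω) * e := by gcongr
  unfold reserve
  rcases le_total (ξ' - ξ) (Real.log 2) with hdouble | hdouble
  · have hgain := one_le_mul_exp_sub_exp hξ hξξ' hdouble hnear
    have hlinear : ξ / Real.log 2 ≤ ξ' / Real.log 2 := by gcongr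
    linarith
  · have hexp : 6 * Real.exp (β - ω) * Real.exp (2 * ξ) ≤
        6 * Real.exp (β - ω) * Real.exp (2 * ξ') := by gcongr
    have hlinear : ξ / Real.log 2 + 1 ≤ ξ' / Real.log 2 := by
      rw [← div_self hlog2.ne', ← add_div]
      gcongr
      linarith
    linarith

lemma reserve_add_one_le_of_damp (hξ : ξ ≤ ξ') (he : e' ≤ e - Real.exp (6 * ξ - 6 * η))
    (hnear : η - ξ - ω ≤ β) : reserve β ω ξ e + 1 ≤ reserve β ω ξ' e' := by
  have hdrop : Real.exp (6 * β + 6 * ω) * e' + 1 ≤ Real.exp (6 * β + 6 * ω) * e :=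
    calc Real.exp (6 * β + 6 * ω) * e' + 1
      _ ≤ Real.exp (6 * β + 6 * ω) * (e - Real.exp (6 * ξ - 6 * η)) +
            Real.exp (6 * β + 6 * ω + (6 * ξ - 6 * η)) := by
          gcongr
          exact Real.one_le_exp (by linarith)
      _ = Real.exp (6 * β + 6 * ω) * e := by rw [Real.exp_add _ (6 * ξ - 6 * η)]; ring
  have hmono := reserve_mono (β := β) (ω := ω) hξ (le_refl e)
  unfold reserve at hmono ⊢
  linarith

lemma potential_add_le_of_far (hβ : 0 ≤ β) (hreserve : reserve β ω ξ e ≤ reserve β ω ξ' e')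
    (hfar : |η' - ξ' - ω| ≤ |η - ξ - ω| + (ξ' - ξ) - β) :
    potential β ω ξ η e + β ≤ potential β ω ξ' η' e' := by
  have := mul_le_mul_of_nonneg_left hreserve hβ
  unfold potential
  linarith

lemma potential_add_le_of_near (hβ : 0 ≤ β) (hξ : ξ ≤ ξ')
    (hreserve : reserve β ω ξ e + 1 ≤ reserve β ω ξ' e') (hη : |η' - η| ≤ β) :
    potential β ω ξ η e + β ≤ potential β ω ξ' η' e' := by
  have hgain := mul_le_mul_of_nonneg_left hreserve hβ
  have hbalance : |η' - ξ' - ω| ≤ |η - ξ - ω| + |η' - η| + |ξ' - ξ| := by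
    rw [show η' - ξ' - ω = η - ξ - ω + (η' - η) - (ξ' - ξ) by ring]
    exact (abs_sub _ _).trans (by gcongr; exact abs_add_le _ _)
  rw [abs_of_nonneg (sub_nonneg.2 hξ)] at hbalance
  unfold potential
  linarith

lemma potential_add_le_of_accept (hβ : 0 ≤ β)
    (hξ : Real.exp (3 * ξ) + 1 / 2 * Real.exp η ≤ Real.exp (3 * ξ')) (he : e' ≤ e) :
    potential β ω ξ η e + β ≤ potential β ω ξ' (η + β) e' := by
  have hξξ' : ξ ≤ ξ' := by
    have : Real.exp (3 * ξ) ≤ Real.exp (3 * ξ') := by linarith [Real.exp_pos η]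
    linarith [Real.exp_le_exp.1 this]
  rcases lt_or_ge (η - ξ - ω) (-β) with hfar | hnear
  · refine potential_add_le_of_far hβ (reserve_mono hξξ' he) ?_
    rw [abs_of_nonpos (by linarith), abs_of_nonpos (by linarith)]
    linarith
  · refine potential_add_le_of_near hβ hξξ' (reserve_add_one_le_of_accept hξ hξξ' he hnear) ?_
    rw [add_sub_cancel_left, abs_of_nonneg hβ]

lemma potential_add_le_of_damp (hβ : 0 ≤ β) (hξ : ξ ≤ ξ')
    (he : e' ≤ e - Real.exp (6 * ξ - 6 * η)) :
    potential β ω ξ η e + β ≤ potential β ω ξ' (η - β) e' := by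
  rcases lt_or_ge β (η - ξ - ω) with hfar | hnear
  · refine potential_add_le_of_far hβ (reserve_mono hξ ?_) ?_
    · linarith [Real.exp_pos (6 * ξ - 6 * η)]
    · rw [abs_of_nonneg (by linarith : 0 ≤ η - ξ - ω), abs_le]
      constructor <;> linarith
  · refine potential_add_le_of_near hβ hξ (reserve_add_one_le_of_damp hξ he hnear) ?_
    rw [sub_sub_cancel_left, abs_neg, abs_of_nonneg hβ]

lemma potential_le (hβ : 0 ≤ β) (hξ : 0 ≤ ξ) (he : 0 ≤ e) :
    potential β (2 / 7 * ξ) ξ η e ≤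
      (1 + 2 * β * (6 * Real.exp β + 1 / Real.log 2)) * Real.exp (12 / 7 * ξ) := by
  have : 0 < Real.log 2 := Real.log_pos one_lt_two
  have hξ_exp : ξ ≤ Real.exp (12 / 7 * ξ) := by linarith [Real.add_one_le_exp (12 / 7 * ξ)]
  have hreserve : reserve β (2 / 7 * ξ) ξ e ≤
      (6 * Real.exp β + 1 / Real.log 2) * Real.exp (12 / 7 * ξ) :=
    calc reserve β (2 / 7 * ξ) ξ e
      _ ≤ 0 + 6 * Real.exp (β - 2 / 7 * ξ) * Real.exp (2 * ξ) +
            Real.exp (12 / 7 * ξ) / Real.log 2 := by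
          unfold reserve
          gcongr
          exact neg_nonpos.2 (by positivity)
      _ = (6 * Real.exp β + 1 / Real.log 2) * Real.exp (12 / 7 * ξ) := by
          rw [mul_assoc 6, ← Real.exp_add,
            show β - 2 / 7 * ξ + 2 * ξ = β + 12 / 7 * ξ by ring, Real.exp_add]
          ring
  have hscaled := mul_le_mul_of_nonneg_left hreserve (mul_nonneg zero_le_two hβ)
  unfold potential
  linarith [abs_nonneg (η - ξ - 2 / 7 * ξ)]

lemma le_potential (hβ : 0 ≤ β) (hξ : 0 ≤ ξ) (hξξ' : ξ ≤ ξ') (he : e ≤ 1) :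
    -((β + 16 / 7 + 2 * β * Real.exp (6 * β)) * Real.exp (12 / 7 * ξ')) ≤
      potential β (2 / 7 * ξ') ξ (3 * ξ + β) e := by
  have : 0 < Real.log 2 := Real.log_pos one_lt_two
  have hexp := Real.add_one_le_exp (12 / 7 * ξ')
  have hbalance : |3 * ξ + β - ξ - 2 / 7 * ξ'| ≤ (β + 16 / 7) * Real.exp (12 / 7 * ξ') := by
    have hβ_exp : β ≤ β * Real.exp (12 / 7 * ξ') := le_mul_of_one_le_right hβ (by linarith)
    rw [abs_le]
    constructor <;> linarith
  have hreserve : -(Real.exp (6 * β) * Real.exp (12 / 7 * ξ')) ≤ reserve β (2 / 7 * ξ') ξ e :=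
    calc -(Real.exp (6 * β) * Real.exp (12 / 7 * ξ'))
      _ = -(Real.exp (6 * β + 6 * (2 / 7 * ξ')) * 1) := by rw [Real.exp_add]; ring_nf
      _ ≤ -(Real.exp (6 * β + 6 * (2 / 7 * ξ')) * e) := by gcongr
      _ ≤ reserve β (2 / 7 * ξ') ξ e := by
          rw [reserve, add_assoc]
          exact le_add_of_nonneg_right (by positivity)
  have hscaled := mul_le_mul_of_nonneg_left hreserve (mul_nonneg zero_le_two hβ)
  unfold potential
  linarith

/-- The constant of the iteration bound, as a function of `β = log α / 2`. -/
def iterConst (β : ℝ) : ℝ :=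
  2 * Real.exp (6 * β) + 12 * Real.exp β + 2 / Real.log 2 + 2 + 4 / β

lemma iterConst_pos (hβ : 0 < β) : 0 < iterConst β := by
  have : 0 < Real.log 2 := Real.log_pos one_lt_two
  unfold iterConst
  positivity

lemma add_one_le_iterConst_mul (hβ : 0 < β) (hξ : 0 ≤ ξ) (hξξ' : ξ ≤ ξ') (he : e ≤ 1)
    (he' : 0 ≤ e') {T : ℝ}
    (h : potential β (2 / 7 * ξ') ξ (3 * ξ + β) e + β * T ≤ potential β (2 / 7 * ξ') ξ' η' e') :
    T + 1 ≤ iterConst β * Real.exp (12 / 7 * ξ') := by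
  have hξ' : 0 ≤ ξ' := hξ.trans hξξ'
  have hexp : 1 ≤ Real.exp (12 / 7 * ξ') := Real.one_le_exp (by positivity)
  have hup := potential_le (η := η') hβ.le hξ' he'
  have hlow := le_potential hβ.le hξ hξξ' he
  refine le_of_mul_le_mul_left ?_ hβ
  have hβ_exp : β ≤ β * Real.exp (12 / 7 * ξ') := le_mul_of_one_le_right hβ.le hexp
  rw [iterConst, ← mul_assoc, mul_add β _ (4 / β), mul_div_cancel₀ _ hβ.ne']
  linear_combination h + hup + hlow + hβ_exp + 5 / 7 * (zero_le_one.trans hexp)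

end Potential

/-- The quantities that drive the iteration count of the outer loop: the weight `A`, the guess `ℓ`
for `λ`, and the energy. -/
structure Progress where
  A : ℝ
  ℓ : ℝ
  energy : ℝ

namespace Progress

/-- One outer iteration: an accepted step increases `√A` at a rate set by `ℓ`, and a damped step
dissipates energy. -/
inductive Step (α c : ℝ) (s s' : Progress) : Prop
  | accept (hA : √s.A + 1 / (2 * √s.ℓ) ≤ √s'.A) (hℓ : s'.ℓ = 1 / α * s.ℓ)
      (henergy : s'.energy ≤ s.energy)
  | damp (hA : s.A ≤ s'.A) (hℓ : s'.ℓ = α * s.ℓ)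
      (henergy : s'.energy ≤ s.energy - c * (s.A * s.ℓ ^ 3))

section Step

variable {α c : ℝ} {s s' : Progress}

lemma Step.A_le (h : Step α c s s') (hA : 0 < s.A) : s.A ≤ s'.A := by
  cases h with
  | accept h =>
    have hsqrt : √s.A ≤ √s'.A := (le_add_of_nonneg_right (by positivity)).trans h
    have hA' : 0 < s'.A := Real.sqrt_pos.1 ((Real.sqrt_pos.2 hA).trans_le hsqrt)
    exact (Real.sqrt_le_sqrt_iff hA'.le).1 hsqrt
  | damp h => exact h

lemma Step.ℓ_pos (h : Step α c s s') (hα : 0 < α) (hℓ : 0 < s.ℓ) : 0 < s'.ℓ := by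
  cases h with
  | accept _ h => rw [h]; positivity
  | damp _ h => rw [h]; positivity

lemma Step.energy_le (h : Step α c s s') (hc : 0 ≤ c) (hA : 0 < s.A) (hℓ : 0 < s.ℓ) :
    s'.energy ≤ s.energy := by
  cases h with
  | accept _ _ h => exact h
  | damp _ _ h => exact h.trans (sub_le_self _ (by positivity))

end Step

/-- The potential of a state, where `κ` fixes the unit of length: `κ * A`, `ℓ / κ` and
`energy / (c * κ ^ 2)` are dimensionless. -/
def potential (α c κ ω : ℝ) (s : Progress) : ℝ :=
  ALEN.potential (Real.log α / 2) ω (Real.log (κ * s.A) / 6) (Real.log (κ / s.ℓ) / 2)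
    (s.energy / (c * κ ^ 2))

lemma Step.potential_add_le {α c κ : ℝ} {s s' : Progress} (h : Step α c s s') (hα : 1 ≤ α)
    (hc : 0 < c) (hκ : 0 < κ) (hA : 0 < s.A) (hℓ : 0 < s.ℓ) (ω : ℝ) :
    potential α c κ ω s + Real.log α / 2 ≤ potential α c κ ω s' := by
  have hα0 : 0 < α := zero_lt_one.trans_le hα
  have hβ : 0 ≤ Real.log α / 2 := div_nonneg (Real.log_nonneg hα) zero_le_two
  have hAA' := h.A_le hA
  have hA' := hA.trans_le hAA'
  have hξ : Real.log (κ * s.A) / 6 ≤ Real.log (κ * s'.A) / 6 := by gcongr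
  have hexp {x : ℝ} (hx : 0 < x) : Real.exp (Real.log x / 2) = √x := by
    rw [Real.exp_half, Real.exp_log hx]
  cases h with
  | accept hsqrt hℓ' he =>
    have hη : Real.log (κ / s'.ℓ) / 2 = Real.log (κ / s.ℓ) / 2 + Real.log α / 2 := by
      rw [hℓ', ← add_div, ← Real.log_mul (by positivity) hα0.ne']
      congr 2
      field_simp
    rw [potential, potential, hη]
    refine potential_add_le_of_accept hβ ?_ (by gcongr)
    have hcube (x : ℝ) : 3 * (Real.log x / 6) = Real.log x / 2 := by ring
    rw [hcube, hcube, hexp (by positivity), hexp (by positivity), hexp (by positivity),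
      Real.sqrt_mul hκ.le, Real.sqrt_mul hκ.le, Real.sqrt_div hκ.le]
    calc √κ * √s.A + 1 / 2 * (√κ / √s.ℓ) = √κ * (√s.A + 1 / (2 * √s.ℓ)) := by ring
      _ ≤ √κ * √s'.A := by gcongr
  | damp _ hℓ' he =>
    have hη : Real.log (κ / s'.ℓ) / 2 = Real.log (κ / s.ℓ) / 2 - Real.log α / 2 := by
      rw [hℓ', ← sub_div, ← Real.log_div (by positivity) hα0.ne']
      congr 2
      field_simp
    rw [potential, potential, hη]
    refine potential_add_le_of_damp hβ hξ ?_
    have hdrop : Real.exp (6 * (Real.log (κ * s.A) / 6) - 6 * (Real.log (κ / s.ℓ) / 2)) =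
        s.A * s.ℓ ^ 3 / κ ^ 2 := by
      rw [show 6 * (Real.log (κ * s.A) / 6) - 6 * (Real.log (κ / s.ℓ) / 2) =
          Real.log (κ * s.A) - (3 : ℕ) * Real.log (κ / s.ℓ) by push_cast; ring, Real.exp_sub,
        Real.exp_nat_mul, Real.exp_log (by positivity), Real.exp_log (by positivity)]
      field_simp
    rw [hdrop]
    calc s'.energy / (c * κ ^ 2) ≤ (s.energy - c * (s.A * s.ℓ ^ 3)) / (c * κ ^ 2) := by gcongr
      _ = s.energy / (c * κ ^ 2) - s.A * s.ℓ ^ 3 / κ ^ 2 := by field_simp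

section Sequence

variable {α c : ℝ} {s : ℕ → Progress}

lemma pos_of_step (hα : 0 < α)
    (hstep : ∀ t, 0 < (s t).A → 0 < (s t).ℓ → Step α c (s t) (s (t + 1))) (hA : 0 < (s 0).A)
    (hℓ : 0 < (s 0).ℓ) (t : ℕ) : 0 < (s t).A ∧ 0 < (s t).ℓ := by
  induction t with
  | zero => exact ⟨hA, hℓ⟩
  | succ t ih =>
    have := hstep t ih.1 ih.2
    exact ⟨ih.1.trans_le (this.A_le ih.1), this.ℓ_pos hα ih.2⟩

lemma energy_antitone (hc : 0 ≤ c) (hpos : ∀ t, 0 < (s t).A ∧ 0 < (s t).ℓ)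
    (hstep : ∀ t, Step α c (s t) (s (t + 1))) : Antitone fun t => (s t).energy :=
  antitone_nat_of_succ_le fun t => (hstep t).energy_le hc (hpos t).1 (hpos t).2

theorem add_one_le_iterConst_mul_rpow {κ : ℝ} (hα : 1 < α) (hc : 0 < c) (hκ : 0 < κ)
    (hpos : ∀ t, 0 < (s t).A ∧ 0 < (s t).ℓ) (hstep : ∀ t, Step α c (s t) (s (t + 1)))
    (hnonneg : ∀ t, 0 ≤ (s t).energy) (hstart : α * (s 0).ℓ * (s 0).A = 1) (hA : 1 ≤ κ * (s 0).A)
    (henergy : (s 0).energy ≤ c * κ ^ 2) (T : ℕ) :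
    (T : ℝ) + 1 ≤ iterConst (Real.log α / 2) * (κ * (s T).A) ^ (2 / 7 : ℝ) := by
  have hα0 : 0 < α := zero_lt_one.trans hα
  have hβ : 0 < Real.log α / 2 := half_pos (Real.log_pos hα)
  obtain ⟨hA0, hℓ0⟩ := hpos 0
  have hmono : Monotone fun t => (s t).A :=
    monotone_nat_of_le_succ fun t => (hstep t).A_le (hpos t).1
  have hgrowth (ω : ℝ) (t : ℕ) :
      potential α c κ ω (s 0) + Real.log α / 2 * t ≤ potential α c κ ω (s t) := by
    induction t with
    | zero => simp
    | succ t ih =>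
      have := (hstep t).potential_add_le hα.le hc hκ (hpos t).1 (hpos t).2 ω
      push_cast
      linarith
  have hη : Real.log (κ / (s 0).ℓ) / 2 = 3 * (Real.log (κ * (s 0).A) / 6) + Real.log α / 2 := by
    have : κ / (s 0).ℓ = κ * (s 0).A * α := by
      rw [div_eq_iff hℓ0.ne']
      linear_combination -κ * hstart
    rw [this, Real.log_mul (by positivity) hα0.ne']
    ring
  have hfinal := hgrowth (2 / 7 * (Real.log (κ * (s T).A) / 6)) T
  rw [potential, hη] at hfinal
  have hξξ' : Real.log (κ * (s 0).A) / 6 ≤ Real.log (κ * (s T).A) / 6 := by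
    have := hmono (Nat.zero_le T)
    gcongr
  have hbound := add_one_le_iterConst_mul hβ (div_nonneg (Real.log_nonneg hA) (by norm_num)) hξξ'
    (div_le_one_of_le₀ henergy (by positivity)) (div_nonneg (hnonneg T) (by positivity)) hfinal
  rwa [show 12 / 7 * (Real.log (κ * (s T).A) / 6) = Real.log (κ * (s T).A) * (2 / 7) by ring,
    ← Real.rpow_def_of_pos (mul_pos hκ (hpos T).1)] at hbound

end Sequence

end Progress

section StepSize

variable {l A : ℝ}

/-- The step size `a'` of the outer loop: the positive root of `l * a ^ 2 = A + a`. -/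
def stepSize (l A : ℝ) : ℝ := 1 / (2 * l) * (1 + √(1 + 4 * l * A))

lemma stepSize_pos (hl : 0 < l) : 0 < stepSize l A := by
  unfold stepSize
  positivity

lemma mul_stepSize_sq (hl : 0 < l) (hA : 0 ≤ A) : l * stepSize l A ^ 2 = A + stepSize l A := by
  have hsqrt : √(1 + 4 * l * A) ^ 2 = 1 + 4 * l * A := Real.sq_sqrt (by positivity)
  unfold stepSize
  generalize √(1 + 4 * l * A) = r at hsqrt ⊢
  field_simp
  linear_combination hsqrt

lemma stepSize_zero (l : ℝ) : stepSize l 0 = 1 / l := by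
  rw [stepSize, mul_zero, add_zero, Real.sqrt_one]
  ring

lemma sqrt_add_le_sqrt_add_stepSize (hl : 0 < l) (hA : 0 ≤ A) :
    √A + 1 / (2 * √l) ≤ √(A + stepSize l A) := by
  have hsqrt : 2 * √l * √A ≤ √(1 + 4 * l * A) := by
    refine Real.le_sqrt_of_sq_le ?_
    rw [mul_pow, mul_pow, Real.sq_sqrt hl.le, Real.sq_sqrt hA]
    linarith
  have hl' : √l ^ 2 = l := Real.sq_sqrt hl.le
  have : 0 < √l := Real.sqrt_pos.2 hl
  calc √A + 1 / (2 * √l) = 1 / (2 * √l) * (1 + 2 * √l * √A) := by field_simp; ring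
    _ ≤ 1 / (2 * √l) * (1 + √(1 + 4 * l * A)) := by gcongr
    _ = √l * stepSize l A := by rw [stepSize, ← hl', Real.sqrt_sq this.le]; field_simp
    _ = √(A + stepSize l A) := by
        rw [← mul_stepSize_sq hl hA, Real.sqrt_mul hl.le, Real.sqrt_sq (stepSize_pos hl).le]

end StepSize

section EnergyInequality

variable {E : Type*} [NormedAddCommGroup E] [InnerProductSpace ℝ E]

lemma mul_inner_add_le_of_norm_add_smul_le {G x : E} {l lam ρ θ : ℝ} (hlam : 0 ≤ lam)
    (hρ : 0 ≤ ρ) (hρl : ρ * lam ≤ l) (h : ‖G + lam • x‖ ≤ θ * (lam * ‖x‖)) :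
    l * ⟪G, x⟫ + ρ / 2 * ‖G‖ ^ 2 ≤ -((1 - θ ^ 2) / 2 * (l * (lam * ‖x‖ ^ 2))) := by
  rcases hlam.eq_or_lt with rfl | hpos
  · have : G = 0 := by simpa using h
    simp [this]
  have hsq : ‖G + lam • x‖ ^ 2 ≤ (θ * (lam * ‖x‖)) ^ 2 := by gcongr
  rw [norm_add_sq_real, inner_smul_right, norm_smul, Real.norm_of_nonneg hlam] at hsq
  refine le_of_mul_le_mul_left ?_ hpos
  calc lam * (l * ⟪G, x⟫ + ρ / 2 * ‖G‖ ^ 2)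
    _ = l * (lam * ⟪G, x⟫) + 1 / 2 * (ρ * lam * ‖G‖ ^ 2) := by ring
    _ ≤ l * (lam * ⟪G, x⟫) + 1 / 2 * (l * ‖G‖ ^ 2) := by gcongr
    _ = l * (‖G‖ ^ 2 + 2 * (lam * ⟪G, x⟫) + (lam * ‖x‖) ^ 2) / 2 - l * (lam * ‖x‖) ^ 2 / 2 := by
        ring
    _ ≤ l * (θ * (lam * ‖x‖)) ^ 2 / 2 - l * (lam * ‖x‖) ^ 2 / 2 := by
        have : 0 ≤ l := (mul_nonneg hρ hlam).trans hρl
        gcongr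
    _ = lam * -((1 - θ ^ 2) / 2 * (l * (lam * ‖x‖ ^ 2))) := by ring

variable [CompleteSpace E] {f : E → ℝ}

lemma linearization_le_inner (hc : ConvexOn ℝ Set.univ f) (hf : Differentiable ℝ f) {A a : ℝ}
    (hA : 0 ≤ A) (ha : 0 ≤ a) {z v zbar : E} (hzbar : (A + a) • zbar = A • z + a • v)
    (zs y : E) :
    A * (f y - f z) + a * (f y - f zs) ≤
      (A + a) * ⟪gradient f y, y - zbar⟫ + a * ⟪gradient f y, v - zs⟫ := by
  have hz := mul_le_mul_of_nonneg_left (add_inner_gradient_le hc hf y z) hA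
  have hzs := mul_le_mul_of_nonneg_left (add_inner_gradient_le hc hf y zs) ha
  have hvec : (A + a) • (y - zbar) + a • (v - zs) = -(A • (z - y) + a • (zs - y)) := by
    rw [smul_sub, hzbar]
    module
  have hinner := congrArg (fun x => ⟪gradient f y, x⟫) hvec
  simp only [inner_add_right, inner_smul_right, inner_neg_right] at hinner
  linarith

/-- Here `ρ` is the damping factor, with `ρ = 1` for an accepted step. -/
lemma damped_energy_le (hc : ConvexOn ℝ Set.univ f) (hf : Differentiable ℝ f)
    {A a l γ ρ θ : ℝ} (hA : 0 ≤ A) (ha : 0 ≤ a) (hla : l * a ^ 2 = A + a) (hγ : 0 ≤ γ)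
    (hρ : 0 ≤ ρ) {z v y zbar : E} (hρl : ρ * (γ * ‖y - zbar‖) ≤ l)
    (hzbar : (A + a) • zbar = A • z + a • v) (hMS : IsMSPoint f γ θ zbar y) (zs : E) :
    ρ * (A * (f y - f z) + a * (f y - f zs)) +
        1 / 2 * ‖v - (ρ * a) • gradient f y - zs‖ ^ 2 ≤
      1 / 2 * ‖v - zs‖ ^ 2 - (1 - θ ^ 2) / 2 * (ρ * (A + a) * (γ * ‖y - zbar‖ ^ 3)) := by
  have hlin := mul_le_mul_of_nonneg_left (linearization_le_inner hc hf hA ha hzbar zs y) hρ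
  have hMS' : ‖gradient f y + (γ * ‖y - zbar‖) • (y - zbar)‖ ≤
      θ * (γ * ‖y - zbar‖ * ‖y - zbar‖) := hMS.trans_eq (by ring)
  have hquad := mul_le_mul_of_nonneg_left
    (mul_inner_add_le_of_norm_add_smul_le (by positivity) hρ hρl hMS')
    (show 0 ≤ ρ * a ^ 2 by positivity)
  have hsq : ‖v - (ρ * a) • gradient f y - zs‖ ^ 2 =
      ‖v - zs‖ ^ 2 - 2 * (ρ * a) * ⟪gradient f y, v - zs⟫ +
        (ρ * a) ^ 2 * ‖gradient f y‖ ^ 2 := by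
    rw [sub_right_comm, norm_sub_sq_real, inner_smul_right, norm_smul,
      Real.norm_of_nonneg (by positivity), real_inner_comm, mul_pow]
    ring
  rw [hsq]
  linear_combination hlin + hquad -
    (ρ * ⟪gradient f y, y - zbar⟫ + (1 - θ ^ 2) / 2 * ρ * (γ * ‖y - zbar‖ ^ 3)) * hla

end EnergyInequality

section Outer

variable {E : Type*} [NormedAddCommGroup E]

/-- The Lyapunov function of the outer loop. -/
def State.energy (f : E → ℝ) (zs : E) (s : State E) : ℝ :=
  s.A * (f s.z - f zs) + 1 / 2 * ‖s.v - zs‖ ^ 2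

/-- The data of a state on which the iteration count depends. -/
def State.progress (f : E → ℝ) (zs : E) (s : State E) : Progress :=
  ⟨s.A, s.lam', s.energy f zs⟩

lemma State.energy_nonneg {f : E → ℝ} {zs : E} (hmin : ∀ z, f zs ≤ f z) {s : State E}
    (hA : 0 ≤ s.A) : 0 ≤ s.energy f zs :=
  add_nonneg (mul_nonneg hA (sub_nonneg.2 (hmin s.z))) (by positivity)

variable [InnerProductSpace ℝ E]

/-- The point `z̄_t` at which the outer loop calls the solver. -/
def State.extrapolation (s : State E) : E :=
  (s.A / (s.A + stepSize s.lam' s.A)) • s.z +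
    (stepSize s.lam' s.A / (s.A + stepSize s.lam' s.A)) • s.v

lemma State.add_smul_extrapolation {s : State E} (hl : 0 < s.lam') (hA : 0 ≤ s.A) :
    (s.A + stepSize s.lam' s.A) • s.extrapolation = s.A • s.z + stepSize s.lam' s.A • s.v := by
  have : s.A + stepSize s.lam' s.A ≠ 0 := (add_pos_of_nonneg_of_pos hA (stepSize_pos hl)).ne'
  rw [extrapolation, smul_add, smul_smul, smul_smul, mul_div_cancel₀ _ this,
    mul_div_cancel₀ _ this]

variable [CompleteSpace E]

/-- The state after accepting the output `c` of the solver. -/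
def State.accept (f : E → ℝ) (α : ℝ) (s : State E) (c : Counted E) : State E where
  z := c.point
  v := s.v - stepSize s.lam' s.A • gradient f c.point
  A := s.A + stepSize s.lam' s.A
  lam' := 1 / α * s.lam'
  steps := s.steps + c.steps
  hessians := s.hessians + c.hessians

/-- The state after a step towards the output `c` of the solver, damped by the factor `ρ`. -/
def State.damp (f : E → ℝ) (α ρ : ℝ) (s : State E) (c : Counted E) : State E where
  z := ((1 - ρ) * s.A / (s.A + ρ * stepSize s.lam' s.A)) • s.z +
    (ρ * (s.A + stepSize s.lam' s.A) / (s.A + ρ * stepSize s.lam' s.A)) • c.point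
  v := s.v - (ρ * stepSize s.lam' s.A) • gradient f c.point
  A := s.A + ρ * stepSize s.lam' s.A
  lam' := α * s.lam'
  steps := s.steps + c.steps
  hessians := s.hessians + c.hessians

variable {f : E → ℝ} {solve : E → Counted E} {α γ θ : ℝ} {s : State E} {c : Counted E}

lemma State.energy_accept_le (hc : ConvexOn ℝ Set.univ f) (hf : Differentiable ℝ f) (hγ : 0 ≤ γ)
    (hl : 0 < s.lam') (hA : 0 ≤ s.A) (hMS : IsMSPoint f γ θ s.extrapolation c.point)
    (hle : γ * ‖c.point - s.extrapolation‖ ≤ s.lam') (α : ℝ) (zs : E) :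
    (s.accept f α c).energy f zs ≤ s.energy f zs - (1 - θ ^ 2) / 2 *
      ((s.A + stepSize s.lam' s.A) * (γ * ‖c.point - s.extrapolation‖ ^ 3)) := by
  have hcore := damped_energy_le hc hf hA (stepSize_pos hl).le (mul_stepSize_sq hl hA) hγ
    zero_le_one (by rwa [one_mul]) (s.add_smul_extrapolation hl hA) hMS zs
  simp only [one_mul] at hcore
  simp only [energy, accept]
  linarith

lemma State.energy_damp_le (hc : ConvexOn ℝ Set.univ f) (hf : Differentiable ℝ f) (hγ : 0 ≤ γ)
    (hl : 0 < s.lam') (hA : 0 ≤ s.A) (hMS : IsMSPoint f γ θ s.extrapolation c.point) {ρ : ℝ}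
    (hρ : 0 < ρ) (hρ1 : ρ ≤ 1) (hle : ρ * (γ * ‖c.point - s.extrapolation‖) ≤ s.lam') (α : ℝ)
    (zs : E) :
    (s.damp f α ρ c).energy f zs ≤ s.energy f zs - (1 - θ ^ 2) / 2 *
      (ρ * (s.A + stepSize s.lam' s.A) * (γ * ‖c.point - s.extrapolation‖ ^ 3)) := by
  have ha := stepSize_pos (A := s.A) hl
  have hcore := damped_energy_le hc hf hA ha.le (mul_stepSize_sq hl hA) hγ hρ.le hle
    (s.add_smul_extrapolation hl hA) hMS zs
  simp only [energy, damp]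
  set a := stepSize s.lam' s.A
  have hA' : 0 < s.A + ρ * a := by positivity
  have hconv : (s.A + ρ * a) * f (((1 - ρ) * s.A / (s.A + ρ * a)) • s.z +
      (ρ * (s.A + a) / (s.A + ρ * a)) • c.point) ≤
        (1 - ρ) * s.A * f s.z + ρ * (s.A + a) * f c.point := by
    refine (mul_le_mul_of_nonneg_left (hc.2 (Set.mem_univ s.z) (Set.mem_univ c.point)
      (div_nonneg (mul_nonneg (sub_nonneg.2 hρ1) hA) hA'.le) (by positivity)
      (by field_simp; ring)) hA'.le).trans_eq ?_
    simp only [smul_eq_mul]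
    field_simp
  linarith

lemma State.step_accept (hc : ConvexOn ℝ Set.univ f) (hf : Differentiable ℝ f) (hγ : 0 ≤ γ)
    (hθ : θ ^ 2 ≤ 1) (hl : 0 < s.lam') (hA : 0 ≤ s.A)
    (hMS : IsMSPoint f γ θ s.extrapolation c.point)
    (hle : γ * ‖c.point - s.extrapolation‖ ≤ s.lam') (zs : E) (δ : ℝ) :
    Progress.Step α δ (s.progress f zs) ((s.accept f α c).progress f zs) := by
  have ha := stepSize_pos (A := s.A) hl
  refine .accept (sqrt_add_le_sqrt_add_stepSize hl hA) rfl
    ((s.energy_accept_le hc hf hγ hl hA hMS hle α zs).trans (sub_le_self _ ?_))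
  exact mul_nonneg (by linarith) (by positivity)

lemma State.step_damp (hc : ConvexOn ℝ Set.univ f) (hf : Differentiable ℝ f) (hγ : 0 < γ)
    (hθ : θ ^ 2 ≤ 1) (hl : 0 < s.lam') (hA : 0 ≤ s.A)
    (hMS : IsMSPoint f γ θ s.extrapolation c.point)
    (hlt : s.lam' < γ * ‖c.point - s.extrapolation‖) (zs : E) :
    Progress.Step α ((1 - θ ^ 2) / (2 * γ ^ 2)) (s.progress f zs)
      ((s.damp f α (s.lam' / (γ * ‖c.point - s.extrapolation‖)) c).progress f zs) := by
  have ha := stepSize_pos (A := s.A) hl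
  set lam := γ * ‖c.point - s.extrapolation‖ with hlam
  have hlam0 : 0 < lam := hl.trans hlt
  have hρ : 0 < s.lam' / lam := div_pos hl hlam0
  have hρlam : s.lam' / lam * lam = s.lam' := div_mul_cancel₀ _ hlam0.ne'
  refine .damp (le_add_of_nonneg_right (by positivity)) rfl
    ((s.energy_damp_le hc hf hγ.le hl hA hMS hρ ((div_le_one hlam0).2 hlt.le) hρlam.le α
      zs).trans ?_)
  have hdist : ‖c.point - s.extrapolation‖ = lam / γ := by rw [hlam]; field_simp
  have hgain : s.A * s.lam' ^ 3 / γ ^ 2 ≤ s.lam' / lam * (s.A + stepSize s.lam' s.A) *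
      (γ * ‖c.point - s.extrapolation‖ ^ 3) :=
    calc s.A * s.lam' ^ 3 / γ ^ 2 = s.lam' * s.A * s.lam' ^ 2 / γ ^ 2 := by ring
      _ ≤ s.lam' * (s.A + stepSize s.lam' s.A) * lam ^ 2 / γ ^ 2 := by gcongr; linarith
      _ = s.lam' / lam * (s.A + stepSize s.lam' s.A) *
          (γ * ‖c.point - s.extrapolation‖ ^ 3) := by rw [hdist]; field_simp
  have hscaled := mul_le_mul_of_nonneg_left hgain (show 0 ≤ (1 - θ ^ 2) / 2 by linarith)
  refine sub_le_sub_left (hscaled.trans_eq' ?_) _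
  change _ = (1 - θ ^ 2) / (2 * γ ^ 2) * (s.A * s.lam' ^ 3)
  field_simp

end Outer

section Run

variable {E : Type*} [NormedAddCommGroup E] [InnerProductSpace ℝ E] [CompleteSpace E]
  {f : E → ℝ} {solve : E → Counted E} {α γ θ D : ℝ} {z₀ zs : E}

lemma run_one (f : E → ℝ) (solve : E → Counted E) (α γ : ℝ) (z₀ : E) :
    run f solve α γ z₀ 1 =
      (run f solve α γ z₀ 0).accept f α ⟨(solve z₀).point, 0, 0⟩ := by
  conv_lhs => rw [run]
  simp only [if_true, le_refl]
  rfl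

lemma run_succ (f : E → ℝ) (solve : E → Counted E) (α γ : ℝ) (z₀ : E) {t : ℕ} (ht : t ≠ 0) :
    run f solve α γ z₀ (t + 1) =
      let s := run f solve α γ z₀ t
      let c := solve s.extrapolation
      let lam := γ * ‖c.point - s.extrapolation‖
      if lam ≤ s.lam' then s.accept f α c else s.damp f α (s.lam' / lam) c := by
  rw [run]
  simp only [if_neg ht]
  rfl

lemma run_zero_lam'_pos (hc : ConvexOn ℝ Set.univ f) (hf : Differentiable ℝ f) (hγ : 0 < γ)
    (hMS : IsMSSolver f γ θ solve) (hz₀ : f zs < f z₀) : 0 < (run f solve α γ z₀ 0).lam' := by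
  refine mul_pos hγ (norm_sub_pos_iff.2 fun hfix => ?_)
  have hgrad : gradient f z₀ = 0 := by
    have := hMS z₀
    rw [IsMSPoint, hfix] at this
    simpa using this
  have hmin := add_inner_gradient_le hc hf z₀ zs
  rw [hgrad, inner_zero_left, add_zero] at hmin
  exact hmin.not_gt hz₀

lemma run_one_A (f : E → ℝ) (solve : E → Counted E) (α γ : ℝ) (z₀ : E) :
    (run f solve α γ z₀ 1).A = 1 / (run f solve α γ z₀ 0).lam' := by
  rw [run_one, ← stepSize_zero, ← zero_add (stepSize _ _)]
  rfl

lemma run_one_lam' (f : E → ℝ) (solve : E → Counted E) (α γ : ℝ) (z₀ : E) :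
    (run f solve α γ z₀ 1).lam' = 1 / α * (run f solve α γ z₀ 0).lam' := by
  rw [run_one]
  rfl

lemma energy_run_one_le (hc : ConvexOn ℝ Set.univ f) (hf : Differentiable ℝ f) (hγ : 0 < γ)
    (hMS : IsMSSolver f γ θ solve) (hl : 0 < (run f solve α γ z₀ 0).lam') (zs : E) :
    (run f solve α γ z₀ 1).energy f zs ≤
      1 / 2 * ‖z₀ - zs‖ ^ 2 - (1 - θ ^ 2) / 2 * ((run f solve α γ z₀ 0).lam' / γ) ^ 2 := by
  have hlam : (run f solve α γ z₀ 0).lam' = γ * ‖(solve z₀).point - z₀‖ := rfl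
  have hA : (run f solve α γ z₀ 0).A = 0 := rfl
  have hext : (run f solve α γ z₀ 0).extrapolation = z₀ := by
    have := State.add_smul_extrapolation hl le_rfl
    rw [hA, zero_add, zero_smul, zero_add] at this
    exact smul_right_injective E (stepSize_pos hl).ne' this
  have haccept := State.energy_accept_le hc hf hγ.le hl le_rfl
    (c := ⟨(solve z₀).point, 0, 0⟩) (by rw [hext]; exact hMS z₀) (by rw [hext, hlam]) α zs
  have henergy : (run f solve α γ z₀ 0).energy f zs = 1 / 2 * ‖z₀ - zs‖ ^ 2 := by
    rw [State.energy, hA, zero_mul, zero_add]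
    rfl
  rw [← run_one, henergy, hA, hext, stepSize_zero, zero_add] at haccept
  refine haccept.trans_eq ?_
  rw [hlam] at hl ⊢
  have : ‖(solve z₀).point - z₀‖ ≠ 0 := (pos_of_mul_pos_right hl hγ.le).ne'
  field_simp

lemma run_step (hc : ConvexOn ℝ Set.univ f) (hf : Differentiable ℝ f) (hγ : 0 < γ)
    (hθ : θ ^ 2 ≤ 1) (hMS : IsMSSolver f γ θ solve) (zs : E) {t : ℕ} (ht : t ≠ 0)
    (hA : 0 ≤ (run f solve α γ z₀ t).A) (hl : 0 < (run f solve α γ z₀ t).lam') :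
    Progress.Step α ((1 - θ ^ 2) / (2 * γ ^ 2)) ((run f solve α γ z₀ t).progress f zs)
      ((run f solve α γ z₀ (t + 1)).progress f zs) := by
  rw [run_succ f solve α γ z₀ ht]
  dsimp only
  split_ifs with hle
  · exact State.step_accept hc hf hγ.le hθ hl hA (hMS _) hle zs _
  · exact State.step_damp hc hf hγ hθ hl hA (hMS _) (not_le.1 hle) zs

/-- The index is shifted by one because the weight `A` vanishes before the first iteration. -/
lemma run_pos (hc : ConvexOn ℝ Set.univ f) (hf : Differentiable ℝ f) (hγ : 0 < γ)
    (hα : 0 < α) (hθ : θ ^ 2 ≤ 1) (hMS : IsMSSolver f γ θ solve) (hz₀ : f zs < f z₀) (t : ℕ) :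
    0 < (run f solve α γ z₀ (t + 1)).A ∧ 0 < (run f solve α γ z₀ (t + 1)).lam' := by
  have hl := run_zero_lam'_pos (α := α) hc hf hγ hMS hz₀
  refine Progress.pos_of_step (s := fun t => (run f solve α γ z₀ (t + 1)).progress f zs) hα
    (fun t hA hl => run_step hc hf hγ hθ hMS zs t.succ_ne_zero hA.le hl) ?_ ?_ t
  · exact (one_div_pos.2 hl).trans_eq (run_one_A ..).symm
  · exact (mul_pos (one_div_pos.2 hα) hl).trans_eq (run_one_lam' ..).symm

lemma run_mul_gap_le (hc : ConvexOn ℝ Set.univ f) (hf : Differentiable ℝ f) (hγ : 0 < γ)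
    (hα : 0 < α) (hθ : θ ^ 2 ≤ 1) (hMS : IsMSSolver f γ θ solve) (hz₀ : f zs < f z₀) (t : ℕ) :
    (run f solve α γ z₀ (t + 1)).A * (f (run f solve α γ z₀ (t + 1)).z - f zs) ≤
      1 / 2 * ‖z₀ - zs‖ ^ 2 := by
  have hpos := run_pos (α := α) hc hf hγ hα hθ hMS hz₀
  have hanti := Progress.energy_antitone
    (s := fun t => (run f solve α γ z₀ (t + 1)).progress f zs)
    (div_nonneg (sub_nonneg.2 hθ) (by positivity)) hpos
    (fun t => run_step hc hf hγ hθ hMS zs t.succ_ne_zero (hpos t).1.le (hpos t).2)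
  calc (run f solve α γ z₀ (t + 1)).A * (f (run f solve α γ z₀ (t + 1)).z - f zs)
    _ ≤ (run f solve α γ z₀ (t + 1)).energy f zs := le_add_of_nonneg_right (by positivity)
    _ ≤ (run f solve α γ z₀ 1).energy f zs := hanti (Nat.zero_le t)
    _ ≤ 1 / 2 * ‖z₀ - zs‖ ^ 2 :=
        (energy_run_one_le hc hf hγ hMS (run_zero_lam'_pos hc hf hγ hMS hz₀) zs).trans
          (sub_le_self _ (mul_nonneg (by linarith) (sq_nonneg _)))

lemma run_zero_lam'_le (hc : ConvexOn ℝ Set.univ f) (hf : Differentiable ℝ f) (hγ : 0 < γ)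
    (hα : 0 < α) (hθ : θ ^ 2 ≤ 3 / 4) (hMS : IsMSSolver f γ θ solve) (hmin : ∀ z, f zs ≤ f z)
    (hz₀ : f zs < f z₀) (hD : ‖z₀ - zs‖ ≤ D) : (run f solve α γ z₀ 0).lam' ≤ 2 * γ * D := by
  have hl := run_zero_lam'_pos (α := α) hc hf hγ hMS hz₀
  have henergy := energy_run_one_le hc hf hγ hMS hl zs
  have hnonneg := State.energy_nonneg hmin
    (run_pos (α := α) hc hf hγ hα (by linarith) hMS hz₀ 0).1.le
  have hratio : ((run f solve α γ z₀ 0).lam' / γ) ^ 2 ≤ (2 * ‖z₀ - zs‖) ^ 2 := by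
    have := mul_le_mul_of_nonneg_right (show 1 / 4 ≤ 1 - θ ^ 2 by linarith)
      (sq_nonneg ((run f solve α γ z₀ 0).lam' / γ))
    linarith
  have := le_of_sq_le_sq hratio (by positivity)
  rw [div_le_iff₀ hγ] at this
  calc (run f solve α γ z₀ 0).lam' ≤ 2 * ‖z₀ - zs‖ * γ := this
    _ ≤ 2 * D * γ := by gcongr
    _ = 2 * γ * D := by ring

lemma add_one_le_iterConst_mul_run_A (hc : ConvexOn ℝ Set.univ f) (hf : Differentiable ℝ f)
    (hγ : 0 < γ) (hα : 1 < α) (hθ : θ ^ 2 ≤ 3 / 4) (hMS : IsMSSolver f γ θ solve)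
    (hmin : ∀ z, f zs ≤ f z) (hz₀ : f zs < f z₀) (hD0 : 0 < D) (hD : ‖z₀ - zs‖ ≤ D) (t : ℕ) :
    (t : ℝ) + 1 ≤ iterConst (Real.log α / 2) *
      (2 * γ * D * (run f solve α γ z₀ (t + 1)).A) ^ (2 / 7 : ℝ) := by
  have hα0 : 0 < α := zero_lt_one.trans hα
  have hθ1 : θ ^ 2 ≤ 1 := by linarith
  have hl := run_zero_lam'_pos (α := α) hc hf hγ hMS hz₀
  have hpos := run_pos (α := α) hc hf hγ hα0 hθ1 hMS hz₀
  refine Progress.add_one_le_iterConst_mul_rpow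
    (s := fun t => (run f solve α γ z₀ (t + 1)).progress f zs)
    (c := (1 - θ ^ 2) / (2 * γ ^ 2)) hα (div_pos (by linarith) (by positivity)) (by positivity)
    hpos
    (fun t => run_step hc hf hγ hθ1 hMS zs t.succ_ne_zero (hpos t).1.le (hpos t).2)
    (fun t => State.energy_nonneg hmin (hpos t).1.le) ?_ ?_ ?_ t
  · change α * (run f solve α γ z₀ 1).lam' * (run f solve α γ z₀ 1).A = 1
    rw [run_one_A, run_one_lam']
    field_simp
  · change 1 ≤ 2 * γ * D * (run f solve α γ z₀ 1).A
    rw [run_one_A, mul_one_div, one_le_div hl]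
    exact run_zero_lam'_le hc hf hγ hα0 hθ hMS hmin hz₀ hD
  · calc (run f solve α γ z₀ 1).energy f zs ≤ 1 / 2 * ‖z₀ - zs‖ ^ 2 :=
          (energy_run_one_le hc hf hγ hMS hl zs).trans
            (sub_le_self _ (mul_nonneg (by linarith) (sq_nonneg _)))
      _ ≤ 2 * (1 - θ ^ 2) * D ^ 2 := by gcongr; linarith
      _ = (1 - θ ^ 2) / (2 * γ ^ 2) * (2 * γ * D) ^ 2 := by field_simp

theorem run_gap_le (hc : ConvexOn ℝ Set.univ f) (hf : Differentiable ℝ f) (hγ : 0 < γ)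
    (hα : 1 < α) (hθ : θ ^ 2 ≤ 3 / 4) (hMS : IsMSSolver f γ θ solve) (hmin : ∀ z, f zs ≤ f z)
    (hz₀ : f zs < f z₀) (hD0 : 0 < D) (hD : ‖z₀ - zs‖ ≤ D) {ε : ℝ} (hε : 0 < ε) {t : ℕ}
    (ht : iterConst (Real.log α / 2) * (γ * D ^ 3 / ε) ^ (2 / 7 : ℝ) < t) :
    f (run f solve α γ z₀ t).z - f zs ≤ ε := by
  have hα0 : 0 < α := zero_lt_one.trans hα
  have hβ := iterConst_pos (half_pos (Real.log_pos hα))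
  obtain ⟨t, rfl⟩ : ∃ k, t = k + 1 := by
    refine Nat.exists_eq_add_one.2 (Nat.cast_pos.1 (ht.trans_le' ?_))
    positivity
  by_contra! hgap
  have hA := (run_pos (α := α) hc hf hγ hα0 (by linarith) hMS hz₀ t).1
  have hgrowth := add_one_le_iterConst_mul_run_A hc hf hγ hα hθ hMS hmin hz₀ hD0 hD t
  have hweight := run_mul_gap_le hc hf hγ hα0 (by linarith) hMS hz₀ t
  set s := run f solve α γ z₀ (t + 1)
  have hAε : s.A ≤ D ^ 2 / (2 * ε) := by
    have := mul_le_mul_of_nonneg_left hgap.le hA.le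
    have : ‖z₀ - zs‖ ^ 2 ≤ D ^ 2 := by gcongr
    rw [le_div_iff₀ (by positivity)]
    linarith
  refine ht.not_ge ?_
  push_cast
  calc (t : ℝ) + 1 ≤ iterConst (Real.log α / 2) * (2 * γ * D * s.A) ^ (2 / 7 : ℝ) := hgrowth
    _ ≤ iterConst (Real.log α / 2) * (2 * γ * D * (D ^ 2 / (2 * ε))) ^ (2 / 7 : ℝ) := by gcongr
    _ = iterConst (Real.log α / 2) * (γ * D ^ 3 / ε) ^ (2 / 7 : ℝ) := by
        congr 2
        field_simp

lemma run_steps {p : ℕ} (hsolve : ∀ z, (solve z).steps = p) (f : E → ℝ) (α γ : ℝ) (z₀ : E)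
    (t : ℕ) : (run f solve α γ z₀ (t + 1)).steps = (t + 1) * p := by
  induction t with
  | zero => rw [zero_add, one_mul, ← hsolve z₀, run_one]; rfl
  | succ t ih =>
    rw [run_succ f solve α γ z₀ t.succ_ne_zero, add_one_mul, ← ih]
    dsimp only
    split_ifs <;> exact congrArg _ (hsolve _)

lemma run_hessians {h : ℕ} (hsolve : ∀ z, (solve z).hessians = h) (f : E → ℝ) (α γ : ℝ)
    (z₀ : E) (t : ℕ) : (run f solve α γ z₀ (t + 1)).hessians = (t + 1) * h := by
  induction t with
  | zero => rw [zero_add, one_mul, ← hsolve z₀, run_one]; rfl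
  | succ t ih =>
    rw [run_succ f solve α γ z₀ t.succ_ne_zero, add_one_mul, ← ih]
    dsimp only
    split_ifs <;> exact congrArg _ (hsolve _)

end Run

section Complexity

variable {L α σ D ε : ℝ} {m : ℕ}

lemma paramM_le (hL : 0 < L) (hm : 1 ≤ m) : paramM L (L / m) m ≤ 18 * (m * L) := by
  have hγ : L / m ≤ L := div_le_self hL.le (by exact_mod_cast hm)
  calc paramM L (L / m) m ≤ 6 * m * (L + 2 * L) := by unfold paramM; gcongr
    _ = 18 * (m * L) := by ring

lemma paramK_le (hL : 0 < L) (hm : 1 ≤ m) (hσ : 0 ≤ σ) :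
    (paramK σ L (L / m) m : ℝ) ≤ 738 * (1 + 4 * σ) * (m * (1 + Real.log m)) := by
  have hm1 : (1 : ℝ) ≤ m := by exact_mod_cast hm
  have hlogm : 0 ≤ Real.log m := Real.log_nonneg hm1
  have hsqrt : √(paramM L (L / m) m / (L / m)) ≤ 5 * m := by
    rw [paramM_div hL hm]
    exact Real.sqrt_le_iff.2 ⟨by positivity, by nlinarith⟩
  have hlog : Real.log (2 * m * (1 + 2 * σ)) ≤ (1 + 4 * σ) * (1 + Real.log m) := by
    rw [show 2 * m * (1 + 2 * σ) = 2 * (1 + 2 * σ) * m by ring,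
      Real.log_mul (by positivity) (by positivity)]
    have := Real.log_le_sub_one_of_pos (show 0 < 2 * (1 + 2 * σ) by positivity)
    have : 0 ≤ σ * Real.log m := mul_nonneg hσ hlogm
    linarith
  have hlog0 : 0 ≤ Real.log (2 * m * (1 + 2 * σ)) := Real.log_nonneg (by nlinarith)
  have hone : 1 ≤ (1 + 4 * σ) * (m * (1 + Real.log m)) :=
    one_le_mul_of_one_le_of_one_le (by linarith)
      (one_le_mul_of_one_le_of_one_le hm1 (by linarith))
  rw [paramK, div_paramc_mul hL hm hσ]
  calc (⌈3 / 2 * (m + 98 * √(paramM L (L / m) m / (L / m))) *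
        Real.log (2 * m * (1 + 2 * σ))⌉₊ : ℝ)
    _ ≤ 3 / 2 * (m + 98 * √(paramM L (L / m) m / (L / m))) *
          Real.log (2 * m * (1 + 2 * σ)) + 1 := (Nat.ceil_lt_add_one (by positivity)).le
    _ ≤ 3 / 2 * (m + 98 * (5 * m)) * ((1 + 4 * σ) * (1 + Real.log m)) + 1 := by gcongr
    _ ≤ 738 * (1 + 4 * σ) * (m * (1 + Real.log m)) := by linarith

lemma ceil_paramK_div_add_two_le (hL : 0 < L) (hm : 1 ≤ m) (hσ : 0 ≤ σ) :
    (⌈(paramK σ L (L / m) m : ℝ) / (m : ℝ)⌉₊ : ℝ) + 2 ≤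
      741 * (1 + 4 * σ) * (1 + Real.log m) := by
  have hm1 : (1 : ℝ) ≤ m := by exact_mod_cast hm
  have hm0 : (0 : ℝ) < m := by linarith
  have hceil := (Nat.ceil_lt_add_one
    (show 0 ≤ (paramK σ L (L / m) m : ℝ) / (m : ℝ) by positivity)).le
  have hdiv : (paramK σ L (L / m) m : ℝ) / (m : ℝ) ≤ 738 * (1 + 4 * σ) * (1 + Real.log m) := by
    rw [div_le_iff₀ hm0]
    linarith [paramK_le hL hm hσ]
  have hone : 1 ≤ (1 + 4 * σ) * (1 + Real.log m) :=
    one_le_mul_of_one_le_of_one_le (by linarith) (by linarith [Real.log_nonneg hm1])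
  linarith

/-- A number of outer iterations of A-LEN that suffices for accuracy `ε`. -/
def outerIterations (α L D ε : ℝ) (m : ℕ) : ℕ :=
  ⌊iterConst (Real.log α / 2) * ((m : ℝ) ^ (-(2 / 7) : ℝ) * (L * D ^ 3 / ε) ^ (2 / 7 : ℝ))⌋₊ + 1

/-- The constant of the complexity bounds. -/
def complexityConst (α σ : ℝ) : ℝ := 741 * (1 + 4 * σ) * (iterConst (Real.log α / 2) + 1)

lemma le_complexityConst (hα : 1 < α) (hσ : 0 ≤ σ) : 741 * (1 + 4 * σ) ≤ complexityConst α σ :=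
  le_mul_of_one_le_right (by positivity)
    (by linarith [iterConst_pos (half_pos (Real.log_pos hα))])

lemma complexityConst_pos (hα : 1 < α) (hσ : 0 ≤ σ) : 0 < complexityConst α σ :=
  (le_complexityConst hα hσ).trans_lt' (by positivity)

lemma outerIterations_le (hα : 1 < α) (hL : 0 ≤ L) (hD : 0 ≤ D) (hε : 0 ≤ ε) :
    (outerIterations α L D ε m : ℝ) ≤ (iterConst (Real.log α / 2) + 1) *
      (1 + (m : ℝ) ^ (-(2 / 7) : ℝ) * (L * D ^ 3 / ε) ^ (2 / 7 : ℝ)) := by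
  have hβ := iterConst_pos (half_pos (Real.log_pos hα))
  rw [outerIterations]
  set X := (m : ℝ) ^ (-(2 / 7) : ℝ) * (L * D ^ 3 / ε) ^ (2 / 7 : ℝ)
  have hX : 0 ≤ X := by positivity
  push_cast
  linarith [Nat.floor_le (mul_nonneg hβ.le hX)]

lemma le_rpow_mul_rpow_of_le_div {X : ℝ} (hm : 1 ≤ m) (hε : 0 < ε) (h : ε ≤ X / m) :
    (m : ℝ) ≤ (m : ℝ) ^ (5 / 7 : ℝ) * (X / ε) ^ (2 / 7 : ℝ) := by
  have hm0 : (0 : ℝ) < m := by exact_mod_cast hm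
  have hmX : (m : ℝ) ≤ X / ε := (le_div_comm₀ hε hm0).1 h
  calc (m : ℝ) = (m : ℝ) ^ (5 / 7 : ℝ) * (m : ℝ) ^ (2 / 7 : ℝ) := by
        rw [← Real.rpow_add hm0]
        norm_num
    _ ≤ (m : ℝ) ^ (5 / 7 : ℝ) * (X / ε) ^ (2 / 7 : ℝ) := by gcongr

section Alen

variable {E : Type*} [NormedAddCommGroup E] [InnerProductSpace ℝ E] [CompleteSpace E]

theorem alen_gap_le {f : E → ℝ} (hc : ConvexOn ℝ Set.univ f) (hf : HasLipschitzHessian f L)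
    (hL : 0 < L) (hm : 1 ≤ m) (hα : 1 < α) (hσ : 0 ≤ σ) (hD : 0 < D) (hε : 0 < ε) {z₀ zs : E}
    (hmin : ∀ z, f zs ≤ f z) (hz₀ : f zs < f z₀) (hz₀D : ‖z₀ - zs‖ ≤ D) {T : ℕ}
    (hT : outerIterations α L D ε m ≤ T) : f (alen f L m α σ z₀ T).z - f zs ≤ ε := by
  have hm0 : (0 : ℝ) < m := by exact_mod_cast hm
  refine run_gap_le hc hf.differentiable (by positivity) hα (by norm_num)
    (hf.isMSSolver_msSolver hc hL hm hσ) hmin hz₀ hD hz₀D hε ?_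
  have hscale : (L / m * D ^ 3 / ε) ^ (2 / 7 : ℝ) =
      (m : ℝ) ^ (-(2 / 7) : ℝ) * (L * D ^ 3 / ε) ^ (2 / 7 : ℝ) := by
    rw [Real.rpow_neg hm0.le, ← Real.inv_rpow hm0.le,
      ← Real.mul_rpow (by positivity) (by positivity)]
    congr 1
    field_simp
  rw [hscale]
  exact Nat.lt_of_floor_lt hT

lemma alen_steps (f : E → ℝ) (L : ℝ) (m : ℕ) (α σ D ε : ℝ) (z₀ : E) :
    (alen f L m α σ z₀ (outerIterations α L D ε m)).steps =
      outerIterations α L D ε m * (⌈(paramK σ L (L / m) m : ℝ) / (m : ℝ)⌉₊ * m + 2) :=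
  run_steps (msSolver_steps f L _ _ m _) f α (L / m) z₀ _

lemma alen_hessians (f : E → ℝ) (L : ℝ) (m : ℕ) (α σ D ε : ℝ) (z₀ : E) :
    (alen f L m α σ z₀ (outerIterations α L D ε m)).hessians =
      outerIterations α L D ε m * (⌈(paramK σ L (L / m) m : ℝ) / (m : ℝ)⌉₊ + 2) :=
  run_hessians (msSolver_hessians f L _ _ m _) f α (L / m) z₀ _

lemma alen_hessians_le (f : E → ℝ) (hL : 0 < L) (hm : 1 ≤ m) (hα : 1 < α) (hσ : 0 ≤ σ)
    (hD : 0 ≤ D) (hε : 0 ≤ ε) (z₀ : E) :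
    ((alen f L m α σ z₀ (outerIterations α L D ε m)).hessians : ℝ) ≤ complexityConst α σ *
      ((1 + (m : ℝ) ^ (-(2 / 7) : ℝ) * (L * D ^ 3 / ε) ^ (2 / 7 : ℝ)) * (1 + Real.log m)) := by
  rw [alen_hessians]
  push_cast
  refine (mul_le_mul (outerIterations_le hα hL.le hD hε) (ceil_paramK_div_add_two_le hL hm hσ)
    (by positivity) ((outerIterations_le hα hL.le hD hε).trans' (by positivity))).trans_eq ?_
  rw [complexityConst]
  ring

lemma alen_steps_le_mul_hessians (f : E → ℝ) (L : ℝ) (hm : 1 ≤ m) (α σ D ε : ℝ) (z₀ : E) :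
    (alen f L m α σ z₀ (outerIterations α L D ε m)).steps ≤
      m * (alen f L m α σ z₀ (outerIterations α L D ε m)).hessians := by
  rw [alen_steps, alen_hessians, mul_left_comm]
  gcongr
  rw [mul_add, mul_comm m]
  gcongr
  omega

lemma alen_steps_le (f : E → ℝ) (hL : 0 < L) (hm : 1 ≤ m) (hα : 1 < α) (hσ : 0 ≤ σ)
    (hD : 0 ≤ D) (hε : 0 ≤ ε) (z₀ : E) :
    ((alen f L m α σ z₀ (outerIterations α L D ε m)).steps : ℝ) ≤ complexityConst α σ *
      ((m + (m : ℝ) ^ (5 / 7 : ℝ) * (L * D ^ 3 / ε) ^ (2 / 7 : ℝ)) * (1 + Real.log m)) := by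
  have hm0 : (0 : ℝ) < m := by exact_mod_cast hm
  have hpow : (m : ℝ) ^ (5 / 7 : ℝ) = m * (m : ℝ) ^ (-(2 / 7) : ℝ) := by
    rw [← Real.rpow_one_add' hm0.le (by norm_num)]
    norm_num
  calc ((alen f L m α σ z₀ (outerIterations α L D ε m)).steps : ℝ)
    _ ≤ m * (alen f L m α σ z₀ (outerIterations α L D ε m)).hessians := by
        exact_mod_cast alen_steps_le_mul_hessians f L hm α σ D ε z₀
    _ ≤ m * (complexityConst α σ * ((1 + (m : ℝ) ^ (-(2 / 7) : ℝ) *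
          (L * D ^ 3 / ε) ^ (2 / 7 : ℝ)) * (1 + Real.log m))) := by
        gcongr
        exact alen_hessians_le f hL hm hα hσ hD hε z₀
    _ = _ := by rw [hpow]; ring

lemma alen_steps_le_of_le_div (f : E → ℝ) (hL : 0 < L) (hm : 1 ≤ m) (hα : 1 < α) (hσ : 0 ≤ σ)
    (hD : 0 ≤ D) (hε : 0 < ε) (hεm : ε ≤ L * D ^ 3 / m) (z₀ : E) :
    ((alen f L m α σ z₀ (outerIterations α L D ε m)).steps : ℝ) ≤ 2 * complexityConst α σ *
      ((m : ℝ) ^ (5 / 7 : ℝ) * (1 + Real.log m) * (L * D ^ 3 / ε) ^ (2 / 7 : ℝ)) := by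
  have hC := complexityConst_pos hα hσ
  calc ((alen f L m α σ z₀ (outerIterations α L D ε m)).steps : ℝ)
    _ ≤ complexityConst α σ * ((m + (m : ℝ) ^ (5 / 7 : ℝ) * (L * D ^ 3 / ε) ^ (2 / 7 : ℝ)) *
          (1 + Real.log m)) := alen_steps_le f hL hm hα hσ hD hε.le z₀
    _ ≤ complexityConst α σ * (((m : ℝ) ^ (5 / 7 : ℝ) * (L * D ^ 3 / ε) ^ (2 / 7 : ℝ) +
          (m : ℝ) ^ (5 / 7 : ℝ) * (L * D ^ 3 / ε) ^ (2 / 7 : ℝ)) * (1 + Real.log m)) := by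
        gcongr
        exact le_rpow_mul_rpow_of_le_div hm hε hεm
    _ = _ := by ring

end Alen

end Complexity

end ALEN

end

theorem theorem4_general.{u} (α σ : ℝ) (hα : 1 < α) (hσ : 0 ≤ σ) :
    ∃ C : ℝ, 0 < C ∧ ∀ (L : ℝ) (m : ℕ), 0 < L → 1 ≤ m →
      ALEN.paramM L (L / m) m ≤ C * (m * L) ∧
      (ALEN.paramK σ L (L / m) m : ℝ) ≤ C * (m * (1 + Real.log m)) ∧
      ∀ D ε : ℝ, 0 < D → 0 < ε → ∃ T : ℕ,
        ∀ (E : Type u) [NormedAddCommGroup E] [InnerProductSpace ℝ E] [CompleteSpace E]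
          (f : E → ℝ) (z₀ zstar : E),
          ConvexOn ℝ Set.univ f → ALEN.HasLipschitzHessian f L →
          (∀ z, f zstar ≤ f z) → f zstar < f z₀ → ‖z₀ - zstar‖ ≤ D →
            (∀ T' : ℕ, T ≤ T' → f (ALEN.alen f L m α σ z₀ T').z - f zstar ≤ ε) ∧
            ((ALEN.alen f L m α σ z₀ T).steps : ℝ) ≤
              C * ((m + (m : ℝ) ^ (5 / 7 : ℝ) * (L * D ^ 3 / ε) ^ (2 / 7 : ℝ)) *
                (1 + Real.log m)) ∧
            (ε ≤ L * D ^ 3 / m →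
              ((ALEN.alen f L m α σ z₀ T).steps : ℝ) ≤
                C * (m + (m : ℝ) ^ (5 / 7 : ℝ) * (1 + Real.log m) *
                  (L * D ^ 3 / ε) ^ (2 / 7 : ℝ))) ∧
            ((ALEN.alen f L m α σ z₀ T).hessians : ℝ) ≤
              C * ((1 + (m : ℝ) ^ (-(2 / 7) : ℝ) * (L * D ^ 3 / ε) ^ (2 / 7 : ℝ)) *
                (1 + Real.log m)) := by
  have hC := ALEN.complexityConst_pos hα hσ
  have hσC := ALEN.le_complexityConst hα hσ
  have hC2 : ALEN.complexityConst α σ ≤ 2 * ALEN.complexityConst α σ := by linarith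
  refine ⟨2 * ALEN.complexityConst α σ, by positivity, fun L m hL hm =>
    ⟨(ALEN.paramM_le hL hm).trans (by gcongr; linarith),
    (ALEN.paramK_le hL hm hσ).trans
      (mul_le_mul_of_nonneg_right (by linarith) (by positivity)), fun D ε hD hε =>
    ⟨ALEN.outerIterations α L D ε m, fun E _ _ _ f z₀ zs hc hf hmin hz₀ hz₀D => ⟨?_, ?_, ?_, ?_⟩⟩⟩⟩
  · exact fun T' hT' => ALEN.alen_gap_le hc hf hL hm hα hσ hD hε hmin hz₀ hz₀D hT'
  · exact (ALEN.alen_steps_le f hL hm hα hσ hD.le hε.le z₀).trans (by gcongr)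
  · exact fun hεm => (ALEN.alen_steps_le_of_le_div f hL hm hα hσ hD.le hε hεm z₀).trans
      (mul_le_mul_of_nonneg_left (le_add_of_nonneg_left m.cast_nonneg) (by positivity))
  · exact (ALEN.alen_hessians_le f hL hm hα hσ hD.le hε.le z₀).trans (by gcongr)

theorem theorem4 (α σ : ℝ) (hα : 1 < α) (hσ : 0 < σ) (hσ' : σ ≤ 99 / 100) :
    ∃ C : ℝ, 0 < C ∧ ∀ (L : ℝ) (m : ℕ), 0 < L → 1 ≤ m →
      ALEN.paramM L (L / m) m ≤ C * (m * L) ∧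
      (ALEN.paramK σ L (L / m) m : ℝ) ≤ C * (m * (1 + Real.log m)) ∧
      ∀ D ε : ℝ, 0 < D → 0 < ε → ∃ T : ℕ,
        ∀ (d : ℕ) (f : EuclideanSpace ℝ (Fin d) → ℝ) (z₀ zstar : EuclideanSpace ℝ (Fin d)),
          ConvexOn ℝ Set.univ f → ALEN.HasLipschitzHessian f L →
          (∀ z, f zstar ≤ f z) → f zstar < f z₀ → ‖z₀ - zstar‖ ≤ D →
            (∀ T' : ℕ, T ≤ T' → f (ALEN.alen f L m α σ z₀ T').z - f zstar ≤ ε) ∧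
            ((ALEN.alen f L m α σ z₀ T).steps : ℝ) ≤
              C * ((m + (m : ℝ) ^ (5 / 7 : ℝ) * (L * D ^ 3 / ε) ^ (2 / 7 : ℝ)) *
                (1 + Real.log m)) ∧
            (ε ≤ L * D ^ 3 / m →
              ((ALEN.alen f L m α σ z₀ T).steps : ℝ) ≤
                C * (m + (m : ℝ) ^ (5 / 7 : ℝ) * (1 + Real.log m) *
                  (L * D ^ 3 / ε) ^ (2 / 7 : ℝ))) ∧
            ((ALEN.alen f L m α σ z₀ T).hessians : ℝ) ≤
              C * ((1 + (m : ℝ) ^ (-(2 / 7) : ℝ) * (L * D ^ 3 / ε) ^ (2 / 7 : ℝ)) *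
                (1 + Real.log m)) := by
  obtain ⟨C, hC, h⟩ := theorem4_general α σ hα hσ.le
  exact ⟨C, hC, fun L m hL hm => (h L m hL hm).imp_right <| And.imp_right fun hT D ε hD hε =>
    (hT D ε hD hε).imp fun _ hE d => hE (EuclideanSpace ℝ (Fin d))⟩
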